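/- Let $-1<\beta\le 0$ and $$A=\begin{pmatrix}1&0&\beta\\ \beta&1&0\\ 0&\beta&1\end{pmatrix},\qquad B=\begin{pmatrix}-\beta&1&0\\ 0&-\beta&1\\ 1&0&-\beta\end{pmatrix}.$$ Let $\Sigma=\Sigma_A\times\Sigma_B$ be the set of pairs $(p^A,p^B)$ of probability vectors in $\mathbb R^3$ ($p^A$ a row vector, $p^B$ a column vector). Let $BR_A(p^B)$ be the set of convex combinations of those unit vectors $P^A_i$ for which $(Ap^B)_i$ is maximal, and $BR_B(p^A)$ the set of convex combinations of those unit vectors $P^B_j$ for which $(p^AB)_j$ is maximal. A trajectory of fictitious play is a locally absolutely continuous curve $(p^A,p^B)\colon[0,\infty)\to\Sigma$ with $$\frac{dp^A}{dt}\in BR_A(p^B)-p^A,\qquad \frac{dp^B}{dt}\in BR_B(p^A)-p^B\qquad\text{for almost every } t.$$ A closed orbit is the set of points of a non-constant periodic trajectory. Let $Z^A_{ij}\subset\Sigma_B$ be the set of $p^B$ for which both $i$ and $j$ are best responses of player A, and $Z^B_{kl}\subset\Sigma_A$ the set of $p^A$ for which both $k$ and $l$ are best responses of player B. The discontinuity set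 is the union of those sets $Z^B_{kl}\times Z^A_{ij}$ ($i\ne j$, $k\ne l$) for which the $2\times2$ game in which A chooses between $i,j$ and B between $k,l$ is of saddle type, i.e. the pure profiles $(i,k)$ and $(j,l)$, or else $(i,l)$ and $(j,k)$, are both equilibria of it; explicitly, it is $$(Z^B_{31}\times Z^A_{12})\cup(Z^B_{12}\times Z^A_{23})\cup(Z^B_{23}\times Z^A_{31}).$$ Then there is exactly one closed orbit. It is the Shapley orbit: one period splits into six consecutive time intervals of positive length, in the interiors of which the unique best responses of the players (A, B) are $(1,2),(2,2),(2,3),(3,3),(3,1),(1,1)$ respectively. Every trajectory that never enters the discontinuity set tends to this closed orbit, i.e. its distance to the closed orbit tends to $0$ as $t\to\infty$. -/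

import Mathlib

open Filter Topology MeasureTheory
open scoped Matrix

noncomputable section

namespace FictitiousPlay

/-- The payoff matrix of player A. Strategies `1, 2, 3` are `0, 1, 2 : Fin 3`, taken cyclically. -/
def payoffA (β : ℝ) : Matrix (Fin 3) (Fin 3) ℝ :=
  !![1, 0, β; β, 1, 0; 0, β, 1]

/-- The payoff matrix of player B. -/
def payoffB (β : ℝ) : Matrix (Fin 3) (Fin 3) ℝ :=
  !![-β, 1, 0; 0, -β, 1; 1, 0, -β]

/-- A state of the game: a pair `(p^A, p^B)`. -/
abbrev State : Type := (Fin 3 → ℝ) × (Fin 3 → ℝ)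

/-- The phase space, the product of the two simplices of mixed strategies. -/
def phaseSpace : Set State := stdSimplex ℝ (Fin 3) ×ˢ stdSimplex ℝ (Fin 3)

/-- The utilities `v^A = A p^B` of the pure strategies of player A. -/
def utilA (β : ℝ) (x : State) : Fin 3 → ℝ := payoffA β *ᵥ x.2

/-- The utilities `v^B = p^A B` of the pure strategies of player B. -/
def utilB (β : ℝ) (x : State) : Fin 3 → ℝ := x.1 ᵥ* payoffB β

/-- The convex hull of the pure strategies with maximal utility: the mixed strategies that give
weight only to coordinates at which `v` is maximal. -/
def bestResponse (v : Fin 3 → ℝ) : Set (Fin 3 → ℝ) :=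
  {a | a ∈ stdSimplex ℝ (Fin 3) ∧ ∀ i, a i ≠ 0 → ∀ j, v j ≤ v i}

/-- `γ`, restricted to `[0, ∞)`, is a fictitious-play trajectory: a locally absolutely continuous
curve in the phase space that satisfies the differential inclusion
`dp^A/dt ∈ BR_A(p^B) - p^A`, `dp^B/dt ∈ BR_B(p^A) - p^B` for almost every `t`.
The values of `γ` at negative times are irrelevant. -/
structure IsTrajectory (β : ℝ) (γ : ℝ → State) : Prop where
  mem_phaseSpace : ∀ t, 0 ≤ t → γ t ∈ phaseSpace
  absolutelyContinuous : ∀ T, 0 ≤ T → AbsolutelyContinuousOnInterval γ 0 T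
  inclusion : ∀ᵐ t : ℝ, 0 < t →
    ∃ a ∈ bestResponse (utilA β (γ t)), ∃ b ∈ bestResponse (utilB β (γ t)),
      HasDerivAt γ (a - (γ t).1, b - (γ t).2) t

/-- A closed orbit: the set of points of a nonconstant periodic trajectory. -/
def IsClosedOrbit (β : ℝ) (O : Set State) : Prop :=
  ∃ (γ : ℝ → State) (T : ℝ), IsTrajectory β γ ∧ 0 < T ∧ (∀ t, 0 ≤ t → γ (t + T) = γ t) ∧
    (∃ t, 0 ≤ t ∧ γ t ≠ γ 0) ∧ O = γ '' Set.Ici 0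

/-- The strategies of player A along the Shapley cycle: `1, 2, 2, 3, 3, 1`. -/
def shapleyA : Fin 6 → Fin 3 := ![0, 1, 1, 2, 2, 0]

/-- The strategies of player B along the Shapley cycle: `2, 2, 3, 3, 1, 1`. -/
def shapleyB : Fin 6 → Fin 3 := ![1, 1, 2, 2, 0, 0]

/-- `O` is a Shapley orbit: the orbit of a periodic trajectory whose period is divided into six
consecutive time intervals of positive length, in the interiors of which the unique best responses
are `shapleyA k` and `shapleyB k`, `k = 0, …, 5`. -/
def IsShapleyOrbit (β : ℝ) (O : Set State) : Prop :=
  ∃ (γ : ℝ → State) (τ : Fin 7 → ℝ), IsTrajectory β γ ∧ StrictMono τ ∧ τ 0 = 0 ∧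
    (∀ t, 0 ≤ t → γ (t + τ (Fin.last 6)) = γ t) ∧
    (∀ (k : Fin 6) (t : ℝ), τ k.castSucc < t → t < τ k.succ →
      (∀ j, j ≠ shapleyA k → utilA β (γ t) j < utilA β (γ t) (shapleyA k)) ∧
      (∀ j, j ≠ shapleyB k → utilB β (γ t) j < utilB β (γ t) (shapleyB k))) ∧
    O = γ '' Set.Ici 0

/-- The set `Z^A_{ij}` (as a condition on the state): both `i` and `j` are best responses of
player A. -/
def IndifferentA (β : ℝ) (i j : Fin 3) (x : State) : Prop :=
  utilA β x i = utilA β x j ∧ ∀ m, utilA β x m ≤ utilA β x i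

/-- The set `Z^B_{kl}` (as a condition on the state): both `k` and `l` are best responses of
player B. -/
def IndifferentB (β : ℝ) (k l : Fin 3) (x : State) : Prop :=
  utilB β x k = utilB β x l ∧ ∀ m, utilB β x m ≤ utilB β x k

/-- In the `2 × 2` game in which A chooses between `i` and `j` and B between `k` and `l`, the pure
profiles `(i, k)` and `(j, l)` are both equilibria, so that the indifference point is a saddle.
(For `-1 < β < 0` all the inequalities are then strict; the weak form covers the limit `β = 0`.) -/
def IsSaddle (β : ℝ) (i j k l : Fin 3) : Prop :=
  i ≠ j ∧ k ≠ l ∧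
    payoffA β j k ≤ payoffA β i k ∧ payoffA β i l ≤ payoffA β j l ∧
    payoffB β i l ≤ payoffB β i k ∧ payoffB β j k ≤ payoffB β j l

/-- The discontinuity set: both players are indifferent, A between `i` and `j` and B between `k`
and `l`, and the associated `2 × 2` game is of saddle type. -/
def discontinuitySet (β : ℝ) : Set State :=
  {x | x ∈ phaseSpace ∧
    ∃ i j k l, IsSaddle β i j k l ∧ IndifferentA β i j x ∧ IndifferentB β k l x}

/-- For `-1 < β ≤ 0` the discontinuity set consists of the three pieces
`Z^B_{31} × Z^A_{12}`, `Z^B_{12} × Z^A_{23}`, `Z^B_{23} × Z^A_{31}`. -/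
theorem mem_discontinuitySet_iff {β : ℝ} (h : -1 < β) (h0 : β ≤ 0) (x : State) :
    x ∈ discontinuitySet β ↔ x ∈ phaseSpace ∧
      ∃ i : Fin 3, IndifferentA β i (i + 1) x ∧ IndifferentB β (i + 2) i x := by
  have hA : ∀ i j, IndifferentA β i j x → IndifferentA β j i x :=
    fun i j hi => ⟨hi.1.symm, fun m => hi.1 ▸ hi.2 m⟩
  have hB : ∀ i j, IndifferentB β i j x → IndifferentB β j i x :=
    fun i j hi => ⟨hi.1.symm, fun m => hi.1 ▸ hi.2 m⟩
  refine and_congr_right fun _ => ⟨?_, ?_⟩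
  · rintro ⟨i, j, k, l, ⟨hij, hkl, h1, h2, h3, h4⟩, ha, hb⟩
    fin_cases i <;> fin_cases j <;> first | exact absurd rfl hij | skip
    all_goals fin_cases k <;> fin_cases l <;> first | exact absurd rfl hkl | skip
    all_goals simp [payoffA, payoffB] at h1 h2 h3 h4
    all_goals first
      | (exfalso; linarith)
      | exact ⟨0, ha, hb⟩
      | exact ⟨1, ha, hb⟩
      | exact ⟨2, ha, hb⟩
      | exact ⟨0, hA _ _ ha, hB _ _ hb⟩
      | exact ⟨1, hA _ _ ha, hB _ _ hb⟩
      | exact ⟨2, hA _ _ ha, hB _ _ hb⟩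
      | exact ⟨0, ha, hB _ _ hb⟩
      | exact ⟨1, ha, hB _ _ hb⟩
      | exact ⟨2, ha, hB _ _ hb⟩
      | exact ⟨0, hA _ _ ha, hb⟩
      | exact ⟨1, hA _ _ ha, hb⟩
      | exact ⟨2, hA _ _ ha, hb⟩
  · rintro ⟨i, ha, hb⟩
    refine ⟨i, i + 1, i, i + 2, ?_, ha, hB _ _ hb⟩
    fin_cases i <;> simp [IsSaddle, payoffA, payoffB] <;> (try constructor) <;> linarith

end FictitiousPlay

end

/-!
Call a state off-cycle of index `i` (`OffCycle`) if `i` is a best response of player A and `i + 2`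
one of player B. These are the three profiles that do not occur in the Shapley cycle; two of the
three closed regions meet exactly in a piece of the discontinuity set.

*The return map.* Off these regions the motion is deterministic (`exists_lead_of_not_offCycle`):
players aim at the profile `(i, i + 1)` until A becomes indifferent between `i` and `i + 1`
(`LeadA`), then at `(i + 1, i + 1)` until B becomes indifferent between `i + 1` and `i + 2`
(`LeadB`), and so on. In each phase the point runs along a segment towards a vertex, so that the
map from one switch of B to the next is projective. In the coordinates given by three positive
utility gaps, and up to cyclic relabelling of the strategies, it is `gapStep`, the map
`v ↦ N v / (ℓ v + 1 + β)` with a nonnegative matrix `N` that has a positive first column, and a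
positive linear form `ℓ` (`IsSection.next`). An eigenvector of `N` with eigenvalue `ρ`, scaled so
that `ℓ w + 1 + β = ρ`, is a fixed point; it exists by the intermediate value theorem
(`exists_gap_fixed`). Conjugating `N` to a stochastic matrix and applying Doeblin's contraction
shows that `N ^ n v / ρ ^ n` tends to a multiple of `w`, while the denominators of the iterates obey
an affine recurrence with ratio `(1 + β) / ρ < 1`; hence all positive orbits of `gapStep` tend to
`w` (`tendsto_iterate_gapStep`). The orbit through `w` closes up after three steps: it is the
Shapley orbit (`isShapleyOrbit_shapleyCurve`), and it attracts every trajectory that is once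
outside the off-cycle regions (`tendsto_infDist_of_isSection`).

*Leaving the off-cycle regions.* A trajectory that avoids the discontinuity set and stays
off-cycle has to stay in a single region, by connectedness. There some utility gap that has to be
nonnegative is driven towards a negative value (`IsTrajectory.exists_offCycle_inter`), a
contradiction.

*Closed orbits.* A periodic trajectory may cross the discontinuity set, so another argument is
needed: in the off-cycle regions the total spread of the utilities, the sum over the players of
their largest minus their smallest utility, decays at least like `exp (-t)`
(`IsTrajectory.exp_mul_spread_le`). A periodic trajectory that stays off-cycle therefore has spread
zero, that is, it rests at the mixed equilibrium. So every closed orbit enters the Shapley cycle; it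
is attracted to the Shapley orbit and, being periodic, equal to it.

Strategies are indexed cyclically by `Fin 3`. A trajectory is controlled through linear observables:
in the time `exp t`, the velocity of an observable is its value at the profile being played
(`IsTrajectory.exp_mul_sub_le`).
-/

namespace FictitiousPlay

/-! ### Absolutely continuous functions -/

theorem _root_.AbsolutelyContinuousOnInterval.lipschitz_comp {X Y : Type*} [PseudoMetricSpace X]
    [PseudoMetricSpace Y] {f : ℝ → X} {a b : ℝ} (hf : AbsolutelyContinuousOnInterval f a b)
    {g : X → Y} {K : NNReal} (hg : LipschitzWith K g) :
    AbsolutelyContinuousOnInterval (fun t => g (f t)) a b := by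
  refine squeeze_zero (fun _ => Finset.sum_nonneg fun _ _ => dist_nonneg) (fun E => ?_)
    (by simpa using Tendsto.const_mul (K : ℝ) hf)
  rw [Finset.mul_sum]
  exact Finset.sum_le_sum fun i _ => hg.dist_le_mul _ _

theorem _root_.AbsolutelyContinuousOnInterval.le_of_ae_deriv_nonpos {f : ℝ → ℝ} {a b : ℝ}
    (hab : a ≤ b) (hf : AbsolutelyContinuousOnInterval f a b)
    (h : ∀ᵐ x, x ∈ Set.Ioo a b → deriv f x ≤ 0) : f b ≤ f a := by
  have h1 := hf.integral_deriv_eq_sub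
  have h2 : ∫ x in a..b, deriv f x ≤ 0 := by
    rw [intervalIntegral.integral_of_le hab, integral_Ioc_eq_integral_Ioo]
    refine setIntegral_nonpos_ae measurableSet_Ioo h
  linarith

/-! ### Utilities and best responses -/

theorem utilA_apply (β : ℝ) (x : State) (i : Fin 3) :
    utilA β x i = x.2 i + β * x.2 (i + 2) := by
  fin_cases i <;> simp [utilA, payoffA, Matrix.mulVec, dotProduct, Fin.sum_univ_three] <;> ring

theorem utilB_apply (β : ℝ) (x : State) (j : Fin 3) :
    utilB β x j = x.1 (j + 2) - β * x.1 j := by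
  fin_cases j <;> simp [utilB, payoffB, Matrix.vecMul, dotProduct, Fin.sum_univ_three] <;> ring

/-- The utility of player A's strategy `i` as a continuous linear functional on states. -/
def utilAL (β : ℝ) (i : Fin 3) : State →L[ℝ] ℝ :=
  (ContinuousLinearMap.proj (R := ℝ) (φ := fun _ : Fin 3 => ℝ) i +
    β • ContinuousLinearMap.proj (i + 2)).comp
    (ContinuousLinearMap.snd ℝ (Fin 3 → ℝ) (Fin 3 → ℝ))

/-- The utility of player B's strategy `j` as a continuous linear functional on states. -/
def utilBL (β : ℝ) (j : Fin 3) : State →L[ℝ] ℝ :=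
  (ContinuousLinearMap.proj (R := ℝ) (φ := fun _ : Fin 3 => ℝ) (j + 2) -
    β • ContinuousLinearMap.proj j).comp
    (ContinuousLinearMap.fst ℝ (Fin 3 → ℝ) (Fin 3 → ℝ))

@[simp] theorem utilAL_apply (β : ℝ) (i : Fin 3) (x : State) :
    utilAL β i x = utilA β x i := by
  simp [utilAL, utilA_apply]

@[simp] theorem utilBL_apply (β : ℝ) (j : Fin 3) (x : State) :
    utilBL β j x = utilB β x j := by
  simp [utilBL, utilB_apply]

theorem continuous_utilA (β : ℝ) (i : Fin 3) : Continuous fun x => utilA β x i := by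
  exact (utilAL β i).continuous.congr (utilAL_apply β i)

theorem continuous_utilB (β : ℝ) (j : Fin 3) : Continuous fun x => utilB β x j := by
  exact (utilBL β j).continuous.congr (utilBL_apply β j)

theorem eq_zero_of_mem_bestResponse {v a : Fin 3 → ℝ} (ha : a ∈ bestResponse v) {i j : Fin 3}
    (h : v j < v i) : a j = 0 := by
  by_contra hj
  exact absurd (ha.2 j hj i) (not_le.2 h)

theorem sum_shift (f : Fin 3 → ℝ) (i : Fin 3) : f i + f (i + 1) + f (i + 2) = ∑ j, f j := by
  rw [Fin.sum_univ_three]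
  fin_cases i <;> simp <;> ring

theorem sum_shift_of_mem {a : Fin 3 → ℝ} (ha : a ∈ stdSimplex ℝ (Fin 3)) (i : Fin 3) :
    a i + a (i + 1) + a (i + 2) = 1 := by
  rw [sum_shift]; exact ha.2

theorem eq_single_of_mem_bestResponse {v a : Fin 3 → ℝ} (ha : a ∈ bestResponse v) {i : Fin 3}
    (h : ∀ j, j ≠ i → v j < v i) : a = Pi.single i 1 := by
  have h0 : ∀ j, j ≠ i → a j = 0 := fun j hj => eq_zero_of_mem_bestResponse ha (h j hj)
  funext j
  by_cases hj : j = i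
  · subst hj
    have := sum_shift_of_mem ha.1 j
    rw [h0 (j + 1) (by simp), h0 (j + 2) (by simp)] at this
    simpa using this
  · rw [h0 j hj, Pi.single_eq_of_ne hj]

theorem single_mem_bestResponse {v : Fin 3 → ℝ} {i : Fin 3} (h : ∀ j, v j ≤ v i) :
    Pi.single i 1 ∈ bestResponse v := by
  refine ⟨single_mem_stdSimplex ℝ i, fun k hk => ?_⟩
  have : k = i := by
    by_contra hne
    exact hk (Pi.single_eq_of_ne hne _)
  exact this ▸ h

theorem forall_ne_fin {P : Fin 3 → Prop} {i : Fin 3} :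
    (∀ j, j ≠ i → P j) ↔ P (i + 1) ∧ P (i + 2) := by
  refine ⟨fun h => ⟨h _ (by simp), h _ (by simp)⟩, fun h j hj => ?_⟩
  have : j = i + 1 ∨ j = i + 2 := by
    clear h; revert i j; decide
  rcases this with rfl | rfl
  exacts [h.1, h.2]

theorem forall_fin {P : Fin 3 → Prop} (i : Fin 3) :
    (∀ j, P j) ↔ P i ∧ P (i + 1) ∧ P (i + 2) := by
  refine ⟨fun h => ⟨h _, h _, h _⟩, fun h j => ?_⟩
  by_cases hj : j = i
  · exact hj ▸ h.1
  · exact forall_ne_fin.2 h.2 j hj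

theorem exists_fin {P : Fin 3 → Prop} (i : Fin 3) :
    (∃ j, P j) ↔ P i ∨ P (i + 1) ∨ P (i + 2) := by
  have := not_congr (forall_fin (P := fun j => ¬ P j) i)
  push Not at this
  rw [this]
  tauto

@[simp] theorem add_one_add_one (i : Fin 3) : i + 1 + 1 = i + 2 := by revert i; decide
@[simp] theorem add_one_add_two (i : Fin 3) : i + 1 + 2 = i := by revert i; decide
@[simp] theorem add_two_add_two (i : Fin 3) : i + 2 + 2 = i + 1 := by revert i; decide

theorem mem_phaseSpace_of_mem_bestResponse {v w a b : Fin 3 → ℝ} (ha : a ∈ bestResponse v)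
    (hb : b ∈ bestResponse w) : ((a, b) : State) ∈ phaseSpace := ⟨ha.1, hb.1⟩

/-! ### Estimates along a trajectory -/

variable {β : ℝ} {γ g : ℝ → State} {i j : Fin 3} {z : State} {v w : Fin 3 → ℝ}

/-- In the time variable `exp t`, the velocity of a linear observable `L` of a trajectory is the
value of `L` at the profile being played, which gives one-sided estimates of `L`. -/
theorem IsTrajectory.exp_mul_sub_le (hγ : IsTrajectory β γ) (L : State →L[ℝ] ℝ) {c s t : ℝ}
    (hs : 0 ≤ s) (hst : s ≤ t)
    (h : ∀ r ∈ Set.Ioo s t, ∀ a ∈ bestResponse (utilA β (γ r)),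
      ∀ b ∈ bestResponse (utilB β (γ r)), L (a, b) ≤ c) :
    Real.exp t * (L (γ t) - c) ≤ Real.exp s * (L (γ s) - c) := by
  have hac : AbsolutelyContinuousOnInterval (fun r => L (γ r)) s t :=
    ((hγ.absolutelyContinuous t (hs.trans hst)).lipschitz_comp L.lipschitz).mono
      (by rw [Set.uIcc_of_le hst, Set.uIcc_of_le (hs.trans hst)]
          exact Set.Icc_subset_Icc_left hs)
  have hc : AbsolutelyContinuousOnInterval (fun _ : ℝ => c) s t :=
    (contDiff_const (n := 1)).contDiffOn.absolutelyContinuousOnInterval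
  have he : AbsolutelyContinuousOnInterval Real.exp s t :=
    (Real.contDiff_exp (n := 1)).contDiffOn.absolutelyContinuousOnInterval
  refine (he.fun_mul (hac.fun_sub hc)).le_of_ae_deriv_nonpos hst ?_
  filter_upwards [hγ.inclusion] with r hr hrst
  obtain ⟨a, ha, b, hb, hd⟩ := hr (hs.trans_lt hrst.1)
  have hL : HasDerivAt (fun r => L (γ r)) (L (a - (γ r).1, b - (γ r).2)) r :=
    L.hasFDerivAt.comp_hasDerivAt r hd
  rw [((Real.hasDerivAt_exp r).fun_mul (hL.sub_const c)).deriv]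
  have e : ((a - (γ r).1, b - (γ r).2) : State) = (a, b) - γ r := rfl
  rw [e, map_sub]
  have := mul_nonneg (Real.exp_pos r).le (sub_nonneg.2 (h r hrst a ha b hb))
  linarith

theorem IsTrajectory.le_of_le (hγ : IsTrajectory β γ) (L : State →L[ℝ] ℝ) {c s t : ℝ}
    (hs : 0 ≤ s) (hst : s ≤ t)
    (h : ∀ r ∈ Set.Ioo s t, ∀ a ∈ bestResponse (utilA β (γ r)),
      ∀ b ∈ bestResponse (utilB β (γ r)), L (a, b) ≤ c) :
    L (γ t) ≤ Real.exp (-(t - s)) * L (γ s) + (1 - Real.exp (-(t - s))) * c := by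
  have h1 := hγ.exp_mul_sub_le L hs hst h
  have h2 : Real.exp (-(t - s)) = Real.exp s / Real.exp t := by
    rw [← Real.exp_sub]; congr 1; ring
  have h3 : L (γ t) - c ≤ Real.exp s / Real.exp t * (L (γ s) - c) := by
    rw [div_mul_eq_mul_div, le_div_iff₀ (Real.exp_pos t)]; linarith
  rw [h2]; linarith

theorem IsTrajectory.eq_of_eq (hγ : IsTrajectory β γ) (L : State →L[ℝ] ℝ) {c s t : ℝ}
    (hs : 0 ≤ s) (hst : s ≤ t)
    (h : ∀ r ∈ Set.Ioo s t, ∀ a ∈ bestResponse (utilA β (γ r)),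
      ∀ b ∈ bestResponse (utilB β (γ r)), L (a, b) = c) :
    L (γ t) = Real.exp (-(t - s)) * L (γ s) + (1 - Real.exp (-(t - s))) * c := by
  refine le_antisymm (hγ.le_of_le L hs hst fun r hr a ha b hb => (h r hr a ha b hb).le) ?_
  have := hγ.le_of_le (-L) (c := -c) hs hst
    fun r hr a ha b hb => by simp [h r hr a ha b hb]
  simp only [neg_apply] at this
  linarith

theorem exp_neg_mem {r : ℝ} (hr : 0 ≤ r) : Real.exp (-r) ≤ 1 ∧ 1 - r ≤ Real.exp (-r) :=
  ⟨Real.exp_le_one_iff.2 (by linarith), by have := Real.add_one_le_exp (-r); linarith⟩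

theorem IsTrajectory.dist_le_of_le (hγ : IsTrajectory β γ) {s t : ℝ} (hs : 0 ≤ s)
    (hst : s ≤ t) : dist (γ t) (γ s) ≤ t - s := by
  have h0 : 0 ≤ t - s := sub_nonneg.2 hst
  obtain ⟨e1, e2⟩ := exp_neg_mem h0
  have key : ∀ L : State →L[ℝ] ℝ, (∀ x ∈ phaseSpace, 0 ≤ L x ∧ L x ≤ 1) →
      dist (L (γ t)) (L (γ s)) ≤ t - s := by
    intro L hL
    have h1 := hγ.le_of_le L (c := 1) hs hst fun r _ a ha b hb =>
      (hL _ (mem_phaseSpace_of_mem_bestResponse ha hb)).2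
    have h2 := hγ.le_of_le (-L) (c := 0) hs hst fun r _ a ha b hb => by
      simpa using (hL _ (mem_phaseSpace_of_mem_bestResponse ha hb)).1
    have h3 := hL _ (hγ.mem_phaseSpace s hs)
    simp only [neg_apply] at h2
    rw [Real.dist_eq, abs_le]
    constructor <;> nlinarith
  rw [Prod.dist_eq, max_le_iff, dist_pi_le_iff h0, dist_pi_le_iff h0]
  constructor <;> intro i
  · refine key ((ContinuousLinearMap.proj i).comp
      (ContinuousLinearMap.fst ℝ (Fin 3 → ℝ) (Fin 3 → ℝ))) fun x hx => ?_
    exact mem_Icc_of_mem_stdSimplex hx.1 i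
  · refine key ((ContinuousLinearMap.proj i).comp
      (ContinuousLinearMap.snd ℝ (Fin 3 → ℝ) (Fin 3 → ℝ))) fun x hx => ?_
    exact mem_Icc_of_mem_stdSimplex hx.2 i

theorem IsTrajectory.lipschitzOnWith (hγ : IsTrajectory β γ) :
    LipschitzOnWith 1 γ (Set.Ici 0) := by
  refine LipschitzOnWith.of_dist_le_mul fun s hs t ht => ?_
  rw [NNReal.coe_one, one_mul]
  rcases le_total s t with h | h
  · rw [dist_comm, dist_comm s, Real.dist_eq]
    exact (hγ.dist_le_of_le hs h).trans (le_abs_self _)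
  · rw [Real.dist_eq]
    exact (hγ.dist_le_of_le ht h).trans (le_abs_self _)

theorem IsTrajectory.continuousOn (hγ : IsTrajectory β γ) : ContinuousOn γ (Set.Ici 0) :=
  hγ.lipschitzOnWith.continuousOn

theorem eq_of_periodic {X : Type*} {f : ℝ → X} {T : ℝ} (hT : 0 < T)
    (hper : ∀ t, 0 ≤ t → f (t + T) = f t) (n : ℕ) {t : ℝ} (ht : 0 ≤ t) : f (t + n * T) = f t := by
  induction n with
  | zero => simp
  | succ n ih =>
    have e : t + (n + 1 : ℕ) * T = t + n * T + T := by push_cast; ring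
    rw [e, hper _ (add_nonneg ht (by positivity)), ih]

/-! ### Iterating a nonnegative matrix with a positive column -/

theorem tendsto_zero_of_le_mul_add {b g : ℕ → ℝ} {q : ℝ} (hq0 : 0 ≤ q) (hq1 : q < 1)
    (hb : ∀ n, 0 ≤ b n) (h : ∀ n, b (n + 1) ≤ q * b n + g n) (hg : Tendsto g atTop (𝓝 0)) :
    Tendsto b atTop (𝓝 0) := by
  refine squeeze_zero' (Eventually.of_forall hb) (g := b) (Eventually.of_forall fun _ => le_rfl) ?_
  rw [Metric.tendsto_atTop]
  intro ε hε
  have hε' : 0 < ε / 2 * (1 - q) := mul_pos (half_pos hε) (sub_pos.2 hq1)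
  obtain ⟨N, hN⟩ := (hg.eventually (gt_mem_nhds hε')).exists_forall_of_atTop
  have key : ∀ k, b (N + k) ≤ q ^ k * b N + ε / 2 := by
    intro k
    induction k with
    | zero => simpa using (half_pos hε).le
    | succ k ih =>
      have h1 := h (N + k)
      have h2 := hN (N + k) (Nat.le_add_right _ _)
      have h3 := mul_le_mul_of_nonneg_left ih hq0
      rw [← add_assoc, pow_succ]
      nlinarith
  have hp : Tendsto (fun k => q ^ k * b N) atTop (𝓝 0) := by
    simpa using (tendsto_pow_atTop_nhds_zero_of_lt_one hq0 hq1).mul_const (b N)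
  obtain ⟨K, hK⟩ := (hp.eventually (gt_mem_nhds (half_pos hε))).exists_forall_of_atTop
  refine ⟨N + K, fun n hn => ?_⟩
  obtain ⟨k, rfl⟩ := Nat.exists_eq_add_of_le ((Nat.le_add_right N K).trans hn)
  have h1 := key k
  have h2 := hK k (by omega)
  rw [Real.dist_eq, sub_zero, abs_of_nonneg (hb _)]
  linarith

theorem tendsto_of_affine_recurrence {a f : ℕ → ℝ} {q l : ℝ} (hq0 : 0 ≤ q) (hq1 : q < 1)
    (h : ∀ n, a (n + 1) = q * a n + f n) (hf : Tendsto f atTop (𝓝 l)) :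
    Tendsto a atTop (𝓝 (l / (1 - q))) := by
  have h1 : 1 - q ≠ 0 := (sub_pos.2 hq1).ne'
  rw [tendsto_iff_dist_tendsto_zero] at hf ⊢
  refine tendsto_zero_of_le_mul_add hq0 hq1 (fun _ => dist_nonneg) (fun n => ?_) hf
  rw [h, Real.dist_eq, Real.dist_eq, Real.dist_eq]
  have e : q * a n + f n - l / (1 - q) = q * (a n - l / (1 - q)) + (f n - l) := by
    field_simp; ring
  rw [e]
  refine (abs_add_le _ _).trans_eq ?_
  rw [abs_mul, abs_of_nonneg hq0]

/-- Repeated averaging with a stochastic matrix that has a positive column leads to consensus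
(Doeblin's condition). -/
theorem exists_tendsto_of_stochastic {ι : Type*} [Fintype ι] {P : Matrix ι ι ℝ}
    (hP : ∀ i j, 0 ≤ P i j) (hrow : ∀ i, ∑ j, P i j = 1) (j₀ : ι) (hcol : ∀ i, 0 < P i j₀)
    {u : ℕ → ι → ℝ} (hu : ∀ n, u (n + 1) = P *ᵥ u n) (hpos : ∀ i, 0 < u 0 i) :
    ∃ κ, 0 < κ ∧ ∀ i, Tendsto (fun n => u n i) atTop (𝓝 κ) := by
  classical
  have : Nonempty ι := ⟨j₀⟩
  have hne : (Finset.univ : Finset ι).Nonempty := Finset.univ_nonempty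
  set lo : ℕ → ℝ := fun n => Finset.univ.inf' hne (u n) with hlo
  set hi : ℕ → ℝ := fun n => Finset.univ.sup' hne (u n) with hhi
  have lo_le : ∀ n i, lo n ≤ u n i := fun n i => Finset.inf'_le _ (Finset.mem_univ i)
  have le_hi : ∀ n i, u n i ≤ hi n := fun n i => Finset.le_sup' _ (Finset.mem_univ i)
  obtain ⟨δ, hδ, hδP⟩ : ∃ δ, 0 < δ ∧ ∀ i, δ ≤ P i j₀ :=
    ⟨Finset.univ.inf' hne fun i => P i j₀, (Finset.lt_inf'_iff _).2 fun i _ => hcol i,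
      fun i => Finset.inf'_le _ (Finset.mem_univ i)⟩
  -- Averaging leaves at least the weight `δ` on the value at `j₀`.
  have step_lo : ∀ n i, lo n + δ * (u n j₀ - lo n) ≤ u (n + 1) i := by
    intro n i
    have h1 : u (n + 1) i = lo n + ∑ j, P i j * (u n j - lo n) := by
      rw [hu]
      simp only [Matrix.mulVec, dotProduct, mul_sub, Finset.sum_sub_distrib,
        ← Finset.sum_mul, hrow]
      ring
    rw [h1]
    have h2 : P i j₀ * (u n j₀ - lo n) ≤ ∑ j, P i j * (u n j - lo n) :=
      Finset.single_le_sum (f := fun j => P i j * (u n j - lo n))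
        (fun j _ => mul_nonneg (hP i j) (sub_nonneg.2 (lo_le n j))) (Finset.mem_univ j₀)
    have h3 := mul_le_mul_of_nonneg_right (hδP i) (sub_nonneg.2 (lo_le n j₀))
    linarith
  have step_hi : ∀ n i, u (n + 1) i ≤ hi n - δ * (hi n - u n j₀) := by
    intro n i
    have h1 : u (n + 1) i = hi n - ∑ j, P i j * (hi n - u n j) := by
      rw [hu]
      simp only [Matrix.mulVec, dotProduct, mul_sub, Finset.sum_sub_distrib,
        ← Finset.sum_mul, hrow]
      ring
    rw [h1]
    have h2 : P i j₀ * (hi n - u n j₀) ≤ ∑ j, P i j * (hi n - u n j) :=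
      Finset.single_le_sum (f := fun j => P i j * (hi n - u n j))
        (fun j _ => mul_nonneg (hP i j) (sub_nonneg.2 (le_hi n j))) (Finset.mem_univ j₀)
    have h3 := mul_le_mul_of_nonneg_right (hδP i) (sub_nonneg.2 (le_hi n j₀))
    linarith
  have lo_step : ∀ n, lo n + δ * (u n j₀ - lo n) ≤ lo (n + 1) := fun n =>
    (Finset.le_inf'_iff _ _).2 fun i _ => step_lo n i
  have hi_step : ∀ n, hi (n + 1) ≤ hi n - δ * (hi n - u n j₀) := fun n =>
    (Finset.sup'_le_iff _ _).2 fun i _ => step_hi n i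
  have hδ1 : δ ≤ 1 := by
    refine (hδP j₀).trans ?_
    rw [← hrow j₀]
    exact Finset.single_le_sum (f := fun j => P j₀ j) (fun j _ => hP j₀ j) (Finset.mem_univ j₀)
  have lo_mono : Monotone lo := monotone_nat_of_le_succ fun n => by
    have := mul_nonneg hδ.le (sub_nonneg.2 (lo_le n j₀))
    linarith [lo_step n]
  have hi_anti : Antitone hi := antitone_nat_of_succ_le fun n => by
    have := mul_nonneg hδ.le (sub_nonneg.2 (le_hi n j₀))
    linarith [hi_step n]
  have hosc : Tendsto (fun n => hi n - lo n) atTop (𝓝 0) := by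
    refine tendsto_zero_of_le_mul_add (q := 1 - δ) (g := fun _ => 0) (by linarith) (by linarith)
      (fun n => sub_nonneg.2 ((lo_le n j₀).trans (le_hi n j₀))) (fun n => ?_) tendsto_const_nhds
    have := lo_step n
    have := hi_step n
    nlinarith
  have hbdd : BddAbove (Set.range lo) := by
    refine ⟨hi 0, ?_⟩
    rintro _ ⟨n, rfl⟩
    exact ((lo_le n j₀).trans (le_hi n j₀)).trans (hi_anti (Nat.zero_le n))
  have hlim := tendsto_atTop_ciSup lo_mono hbdd
  refine ⟨⨆ n, lo n, ?_, fun i => ?_⟩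
  · exact ((Finset.lt_inf'_iff _).2 fun i _ => hpos i).trans_le (le_ciSup hbdd 0)
  · have hlim' : Tendsto hi atTop (𝓝 (⨆ n, lo n)) := by
      simpa using hlim.add hosc
    exact tendsto_of_tendsto_of_tendsto_of_le_of_le hlim hlim' (fun n => lo_le n i)
      fun n => le_hi n i

/-- Power iteration: for a nonnegative matrix with a positive column and a positive eigenvector `w`,
the normalised powers applied to a positive vector converge to a positive multiple of `w`. -/
theorem exists_tendsto_pow_mulVec {ι : Type*} [Fintype ι] [DecidableEq ι] {N : Matrix ι ι ℝ}
    (hN : ∀ i j, 0 ≤ N i j) (j₀ : ι) (hcol : ∀ i, 0 < N i j₀) {w : ι → ℝ} {ρ : ℝ}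
    (hw : ∀ i, 0 < w i) (hρ : 0 < ρ) (hNw : N *ᵥ w = ρ • w) {v : ι → ℝ} (hv : ∀ i, 0 < v i) :
    ∃ κ, 0 < κ ∧ ∀ i, Tendsto (fun n : ℕ => (N ^ n *ᵥ v) i / ρ ^ n) atTop (𝓝 (κ * w i)) := by
  obtain ⟨κ, hκ, h⟩ := exists_tendsto_of_stochastic
    (P := fun i j => N i j * w j / (ρ * w i)) (u := fun n i => (N ^ n *ᵥ v) i / (ρ ^ n * w i))
    (fun i j => div_nonneg (mul_nonneg (hN i j) (hw j).le) (mul_pos hρ (hw i)).le)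
    (fun i => by
      rw [← Finset.sum_div, div_eq_one_iff_eq (mul_pos hρ (hw i)).ne']
      exact congrFun hNw i)
    j₀ (fun i => div_pos (mul_pos (hcol i) (hw j₀)) (mul_pos hρ (hw i)))
    (fun n => by
      funext i
      simp only [pow_succ', ← Matrix.mulVec_mulVec]
      generalize N ^ n *ᵥ v = y
      simp only [Matrix.mulVec, dotProduct, Finset.sum_div]
      refine Finset.sum_congr rfl fun j _ => ?_
      have h1 := (hw i).ne'
      have h2 := (hw j).ne'
      have h3 := hρ.ne'
      field_simp)
    (fun i => by simpa using div_pos (hv i) (hw i))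
  refine ⟨κ, hκ, fun i => ?_⟩
  refine ((h i).mul_const (w i)).congr fun n => ?_
  have h1 := (hw i).ne'
  field_simp

/-! ### The return map of the Shapley cycle -/

/-- The linear part of the map between consecutive sections of the Shapley cycle. A section vector
`v` lists the gaps between the best and the two other utilities of A (`v 0` for the strategy that A
turns to next) and the gap between the two best and the worst utility of B. -/
def gapMatrix (β : ℝ) : Matrix (Fin 3) (Fin 3) ℝ :=
  !![1 - 2 * β - β ^ 2, 1 + β, 1 - β; 1, 0, 1; 1 + β + β ^ 2, 0, -β]

/-- The variable part of the denominator of the map between consecutive sections. -/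
def gapWeight (β : ℝ) (v : Fin 3 → ℝ) : ℝ := (2 + β) * v 0 + v 2

/-- The map between consecutive sections of the Shapley cycle, a projective map. -/
noncomputable def gapStep (β : ℝ) (v : Fin 3 → ℝ) : Fin 3 → ℝ :=
  (gapWeight β v + (1 + β))⁻¹ • (gapMatrix β *ᵥ v)

theorem gapMatrix_nonneg {β : ℝ} (h : -1 < β) (h0 : β ≤ 0) (i j : Fin 3) :
    0 ≤ gapMatrix β i j := by
  fin_cases i <;> fin_cases j <;> simp [gapMatrix] <;> nlinarith

theorem gapMatrix_col_pos {β : ℝ} (h : -1 < β) (h0 : β ≤ 0) (i : Fin 3) :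
    0 < gapMatrix β i 0 := by
  fin_cases i <;> simp [gapMatrix]; all_goals nlinarith

theorem gapMatrix_mulVec (β : ℝ) (v : Fin 3 → ℝ) :
    gapMatrix β *ᵥ v = ![(1 - 2 * β - β ^ 2) * v 0 + (1 + β) * v 1 + (1 - β) * v 2,
      v 0 + v 2, (1 + β + β ^ 2) * v 0 - β * v 2] := by
  funext i
  fin_cases i <;> simp [gapMatrix, Matrix.mulVec, dotProduct, Fin.sum_univ_three]; ring

theorem gapWeight_pos {β : ℝ} (h : -1 < β) {v : Fin 3 → ℝ} (hv : ∀ i, 0 < v i) :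
    0 < gapWeight β v :=
  add_pos (mul_pos (by linarith) (hv 0)) (hv 2)

theorem gapStep_pos {β : ℝ} (h : -1 < β) (h0 : β ≤ 0) {v : Fin 3 → ℝ} (hv : ∀ i, 0 < v i)
    (i : Fin 3) : 0 < gapStep β v i := by
  refine mul_pos (inv_pos.2 (add_pos (gapWeight_pos h hv) (by linarith))) ?_
  exact (mul_pos (gapMatrix_col_pos h h0 i) (hv 0)).trans_le
    (Finset.single_le_sum (f := fun j => gapMatrix β i j * v j)
      (fun j _ => mul_nonneg (gapMatrix_nonneg h h0 i j) (hv j).le) (Finset.mem_univ 0))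

/-- The eigenvalue equation for a fixed point of the section map, in terms of the Perron eigenvector
of `gapMatrix`, has a positive solution. -/
theorem exists_gap_fixed {β : ℝ} (h : -1 < β) (h0 : β ≤ 0) :
    ∃ w : Fin 3 → ℝ, (∀ i, 0 < w i) ∧
      gapMatrix β *ᵥ w = (gapWeight β w + (1 + β)) • w := by
  -- The first coordinate of the eigenvalue equation, for a vector with first coordinate `1`, once
  -- the other two coordinates have been solved for.
  let f : ℝ → ℝ := fun ρ => 1 - 2 * β - β ^ 2 +
    (1 + β) * ((1 + (1 + β + β ^ 2) / (ρ + β)) / ρ) +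
    (1 - β) * ((1 + β + β ^ 2) / (ρ + β)) - ρ
  have hk : 0 < 1 + β + β ^ 2 := by nlinarith
  have hf : ContinuousOn f (Set.Icc 1 10) := by
    have h1 : ∀ ρ ∈ Set.Icc (1 : ℝ) 10, ρ + β ≠ 0 := fun ρ hρ => by linarith [hρ.1]
    have h2 : ∀ ρ ∈ Set.Icc (1 : ℝ) 10, ρ ≠ 0 := fun ρ hρ => by linarith [hρ.1]
    fun_prop (disch := assumption)
  have f1 : 0 ≤ f 1 := by
    have : 0 ≤ (1 + β + β ^ 2) / (1 + β) := (div_pos hk (by linarith)).le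
    have := mul_nonneg (by linarith : 0 ≤ 1 + β) this
    have := mul_nonneg (by linarith : 0 ≤ 1 - β) ‹0 ≤ (1 + β + β ^ 2) / (1 + β)›
    simp only [f, div_one]
    nlinarith
  have f10 : f 10 ≤ 0 := by
    have h1 : (1 + β + β ^ 2) / (10 + β) ≤ 1 := by
      rw [div_le_one (by linarith)]; nlinarith
    have h2 : 0 ≤ (1 + β + β ^ 2) / (10 + β) := (div_pos hk (by linarith)).le
    simp only [f]
    nlinarith
  obtain ⟨ρ, hρ, hfρ⟩ := intermediate_value_Icc' (by norm_num) hf ⟨f10, f1⟩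
  have hρ1 := hρ.1
  have hρβ : 0 < ρ + β := by linarith
  have hρ0 : 0 < ρ := by linarith
  let s : ℝ := (1 + β + β ^ 2) / (ρ + β)
  have hs : 0 < s := div_pos hk hρβ
  have hsρ : s * (ρ + β) = 1 + β + β ^ 2 := div_mul_cancel₀ _ hρβ.ne'
  have hρ' : 0 < ρ - (1 + β) := by
    rcases eq_or_lt_of_le h0 with rfl | hβ
    · refine sub_pos.2 (lt_of_le_of_ne (by linarith) fun e => ?_)
      rw [← e] at hfρ
      norm_num [f] at hfρ
    · linarith
  let m : ℝ := (ρ - (1 + β)) / (2 + β + s)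
  have hden : 0 < 2 + β + s := by linarith
  have hm : 0 < m := div_pos hρ' hden
  have hmden : m * (2 + β + s) = ρ - (1 + β) := div_mul_cancel₀ _ hden.ne'
  have hweight : gapWeight β (m • ![1, (1 + s) / ρ, s]) + (1 + β) = ρ := by
    simp [gapWeight]; linarith
  refine ⟨m • ![1, (1 + s) / ρ, s], fun i => ?_, ?_⟩
  · have : 0 < (1 + s) / ρ := div_pos (by linarith) hρ0
    fin_cases i <;> simp [hm, hs, this]
  · have hfρ' : 1 - 2 * β - β ^ 2 + (1 + β) * ((1 + s) / ρ) + (1 - β) * s = ρ := by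
      simp only [f] at hfρ
      linarith
    rw [hweight, Matrix.mulVec_smul, smul_comm]
    congr 1
    rw [gapMatrix_mulVec]
    funext i
    fin_cases i
    · simp; linarith
    · simp; field_simp
    · simp; linarith

theorem gapStep_fixed {β : ℝ} (h : -1 < β) {w : Fin 3 → ℝ} (hw : ∀ i, 0 < w i)
    (hfix : gapMatrix β *ᵥ w = (gapWeight β w + (1 + β)) • w) : gapStep β w = w := by
  rw [gapStep, hfix, inv_smul_smul₀]
  exact (add_pos (gapWeight_pos h hw) (by linarith)).ne'

/-- All orbits of the section map in the positive octant converge to its fixed point. -/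
theorem tendsto_iterate_gapStep {β : ℝ} (h : -1 < β) (h0 : β ≤ 0) {w : Fin 3 → ℝ}
    (hw : ∀ i, 0 < w i) (hfix : gapMatrix β *ᵥ w = (gapWeight β w + (1 + β)) • w)
    {v : Fin 3 → ℝ} (hv : ∀ i, 0 < v i) :
    Tendsto (fun n => (gapStep β)^[n] v) atTop (𝓝 w) := by
  set ρ := gapWeight β w + (1 + β) with hρdef
  have hℓ := gapWeight_pos h hw
  have hρ : 0 < ρ := by linarith
  set W : ℕ → Fin 3 → ℝ := fun n => gapMatrix β ^ n *ᵥ v with hW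
  obtain ⟨κ, hκ, hlim⟩ := exists_tendsto_pow_mulVec (gapMatrix_nonneg h h0) 0
    (gapMatrix_col_pos h h0) hw hρ hfix hv
  -- The iterates are `W n / S n`, where the denominators `S n` solve a linear recurrence.
  let S : ℕ → ℝ := fun n => Nat.rec 1 (fun n s => gapWeight β (W n) + (1 + β) * s) n
  have hS : ∀ n, S (n + 1) = gapWeight β (W n) + (1 + β) * S n := fun n => rfl
  have hWS : ∀ n, 0 < S n ∧ (∀ i, 0 < (gapStep β)^[n] v i) ∧ W n = S n • (gapStep β)^[n] v := by
    intro n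
    induction n with
    | zero => simp [S, W, hv]
    | succ n ih =>
      obtain ⟨h1, h2, h3⟩ := ih
      have hwt := gapWeight_pos h h2
      have e : S (n + 1) = S n * (gapWeight β ((gapStep β)^[n] v) + (1 + β)) := by
        rw [hS, h3]; simp [gapWeight]; ring
      refine ⟨?_, ?_, ?_⟩
      · rw [e]; exact mul_pos h1 (by linarith)
      · rw [Function.iterate_succ_apply']; exact gapStep_pos h h0 h2
      · have h4 : W (n + 1) = gapMatrix β *ᵥ W n := by
          simp only [W]
          rw [pow_succ', Matrix.mulVec_mulVec]
        rw [h4, h3, Matrix.mulVec_smul, Function.iterate_succ_apply', gapStep, e, smul_smul,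
          mul_assoc, mul_inv_cancel₀ (by linarith), mul_one]
  have hSlim : Tendsto (fun n => S n / ρ ^ n) atTop (𝓝 κ) := by
    have h1 : Tendsto (fun n => gapWeight β (fun i => W n i / ρ ^ n) / ρ) atTop
        (𝓝 (gapWeight β (fun i => κ * w i) / ρ)) :=
      (((hlim 0).const_mul _).add (hlim 2)).div_const ρ
    have h2 := tendsto_of_affine_recurrence (a := fun n => S n / ρ ^ n) (q := (1 + β) / ρ)
      (div_pos (by linarith) hρ).le ((div_lt_one hρ).2 (by linarith)) (fun n => by
        rw [hS, pow_succ]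
        simp only [gapWeight]
        field_simp
        ring) h1
    convert h2 using 2
    have e : gapWeight β (fun i => κ * w i) = κ * (ρ - (1 + β)) := by
      simp only [hρdef, gapWeight]; ring
    have hne : ρ - (1 + β) ≠ 0 := by rw [hρdef]; simpa using hℓ.ne'
    rw [e]
    field_simp
  rw [tendsto_pi_nhds]
  intro i
  have h1 := (hlim i).div hSlim hκ.ne'
  rw [mul_div_cancel_left₀ _ hκ.ne'] at h1
  refine h1.congr fun n => ?_
  have h2 : W n i = S n * (gapStep β)^[n] v i := congrFun (hWS n).2.2 i
  have h3 := (hWS n).1.ne'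
  have h4 := (pow_pos hρ n).ne'
  change W n i / ρ ^ n / (S n / ρ ^ n) = _
  rw [h2]
  field_simp

/-! ### The two kinds of phases of the Shapley cycle -/

/-- The state reached after time `r` from `z` while the profile `E` is played. -/
noncomputable def approach (E z : State) (r : ℝ) : State :=
  Real.exp (-r) • z + (1 - Real.exp (-r)) • E

/-- The pure profile `(i, j)`. -/
def profile (i j : Fin 3) : State := (Pi.single i 1, Pi.single j 1)

/-- `i` is the unique best response of player A. -/
def StrictA (β : ℝ) (i : Fin 3) (x : State) : Prop := ∀ m, m ≠ i → utilA β x m < utilA β x i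

/-- `j` is the unique best response of player B. -/
def StrictB (β : ℝ) (j : Fin 3) (x : State) : Prop := ∀ m, m ≠ j → utilB β x m < utilB β x j

/-- A plays `i`, and B plays or is about to play `i + 1`. -/
def LeadA (β : ℝ) (i : Fin 3) (x : State) : Prop :=
  StrictA β i x ∧ utilB β x (i + 2) < utilB β x (i + 1) ∧ utilB β x i ≤ utilB β x (i + 1)

/-- B plays `i`, and A plays or is about to play `i`. -/
def LeadB (β : ℝ) (i : Fin 3) (x : State) : Prop :=
  StrictB β i x ∧ utilA β x (i + 1) < utilA β x i ∧ utilA β x (i + 2) ≤ utilA β x i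

theorem utilA_approach (β : ℝ) (E z : State) (r : ℝ) (i : Fin 3) :
    utilA β (approach E z r) i =
      Real.exp (-r) * utilA β z i + (1 - Real.exp (-r)) * utilA β E i := by
  simp only [← utilAL_apply, approach, map_add, map_smul, smul_eq_mul]

theorem utilB_approach (β : ℝ) (E z : State) (r : ℝ) (i : Fin 3) :
    utilB β (approach E z r) i =
      Real.exp (-r) * utilB β z i + (1 - Real.exp (-r)) * utilB β E i := by
  simp only [← utilBL_apply, approach, map_add, map_smul, smul_eq_mul]

theorem utilA_profile (β : ℝ) (i j : Fin 3) :
    utilA β (profile i j) j = 1 ∧ utilA β (profile i j) (j + 1) = β ∧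
      utilA β (profile i j) (j + 2) = 0 := by
  simp [utilA_apply, profile]

theorem utilB_profile (β : ℝ) (i j : Fin 3) :
    utilB β (profile i j) i = -β ∧ utilB β (profile i j) (i + 1) = 1 ∧
      utilB β (profile i j) (i + 2) = 0 := by
  simp [utilB_apply, profile]

theorem strictA_iff {β : ℝ} {i : Fin 3} {x : State} : StrictA β i x ↔
    utilA β x (i + 1) < utilA β x i ∧ utilA β x (i + 2) < utilA β x i := forall_ne_fin

theorem strictB_iff {β : ℝ} {i : Fin 3} {x : State} : StrictB β i x ↔
    utilB β x (i + 1) < utilB β x i ∧ utilB β x (i + 2) < utilB β x i := forall_ne_fin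

theorem utilB_congr {β : ℝ} {x y : State} (h : x.1 = y.1) : utilB β x = utilB β y := by
  simp [utilB, h]

theorem utilA_congr {β : ℝ} {x y : State} (h : x.2 = y.2) : utilA β x = utilA β y := by
  simp [utilA, h]

/-- The time during which A keeps playing `i` from a state with `LeadA β i`. -/
noncomputable def timeA (β : ℝ) (i : Fin 3) (z : State) : ℝ :=
  Real.log (1 + (utilA β z i - utilA β z (i + 1)))

/-- The time during which B keeps playing `i` from a state with `LeadB β i`. -/
noncomputable def timeB (β : ℝ) (i : Fin 3) (z : State) : ℝ :=
  Real.log (1 + (utilB β z i - utilB β z (i + 1)) / (1 + β))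

theorem LeadA.timeA_pos (h : LeadA β i z) : 0 < timeA β i z :=
  Real.log_pos (by linarith [(strictA_iff.1 h.1).1])

theorem LeadB.timeB_pos (hβ : -1 < β) (h : LeadB β i z) : 0 < timeB β i z := by
  refine Real.log_pos (lt_add_of_pos_right _ (div_pos ?_ (by linarith)))
  linarith [(strictB_iff.1 h.1).1]

theorem exp_neg_timeA (h : LeadA β i z) :
    Real.exp (-timeA β i z) * (1 + (utilA β z i - utilA β z (i + 1))) = 1 := by
  have : 0 < 1 + (utilA β z i - utilA β z (i + 1)) := by linarith [(strictA_iff.1 h.1).1]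
  rw [timeA, Real.exp_neg, Real.exp_log this, inv_mul_cancel₀ this.ne']

theorem exp_neg_timeB (hβ : -1 < β) (h : LeadB β i z) :
    Real.exp (-timeB β i z) * (1 + β + (utilB β z i - utilB β z (i + 1))) = 1 + β := by
  have h1 : 0 < 1 + β := by linarith
  have h2 := (strictB_iff.1 h.1).1
  have h3 : 0 < 1 + (utilB β z i - utilB β z (i + 1)) / (1 + β) :=
    add_pos one_pos (div_pos (by linarith) h1)
  have h4 : 1 + β + (utilB β z i - utilB β z (i + 1)) =
      (1 + (utilB β z i - utilB β z (i + 1)) / (1 + β)) * (1 + β) := by field_simp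
  rw [timeB, Real.exp_neg, Real.exp_log h3, h4, ← mul_assoc, inv_mul_cancel₀ h3.ne', one_mul]

/-- While A plays `i`, all utility gaps that define the profile `(i, i + 1)` stay positive, except
that the gap between `i` and `i + 1` for A vanishes at time `timeA`. -/
theorem LeadA.gaps (hβ : -1 < β) (hβ0 : β ≤ 0) (h : LeadA β i z) {r : ℝ} (hr : 0 < r) :
    utilA β (approach (profile i (i + 1)) z r) (i + 2) <
        utilA β (approach (profile i (i + 1)) z r) i ∧
      StrictB β (i + 1) (approach (profile i (i + 1)) z r) := by
  have hlt : Real.exp (-r) < 1 := Real.exp_lt_one_iff.2 (by linarith)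
  have hpos := Real.exp_pos (-r)
  obtain ⟨a1, a2, a3⟩ := utilA_profile β i (i + 1)
  obtain ⟨b1, b2, b3⟩ := utilB_profile β i (i + 1)
  obtain ⟨h1, h2, h3⟩ := h
  rw [strictA_iff] at h1
  simp only [add_one_add_one, add_one_add_two] at a2 a3
  rw [strictB_iff]
  simp only [utilA_approach, utilB_approach, a2, a3, b1, b2, b3, add_one_add_one,
    add_one_add_two]
  refine ⟨?_, ?_, ?_⟩
  · nlinarith
  · nlinarith
  · nlinarith

theorem LeadA.strictA (hβ : -1 < β) (hβ0 : β ≤ 0) (h : LeadA β i z) {r : ℝ} (hr : 0 ≤ r)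
    (hrT : r < timeA β i z) : StrictA β i (approach (profile i (i + 1)) z r) := by
  rcases hr.eq_or_lt with rfl | hr
  · simpa [approach] using h.1
  have hlt : Real.exp (-timeA β i z) < Real.exp (-r) := Real.exp_lt_exp.2 (by linarith)
  have h1 := exp_neg_timeA h
  refine strictA_iff.2 ⟨?_, (h.gaps hβ hβ0 hr).1⟩
  obtain ⟨a1, a2, a3⟩ := utilA_profile β i (i + 1)
  have h2 := (strictA_iff.1 h.1).1
  simp only [add_one_add_two] at a3
  simp only [utilA_approach, a1, a3]
  nlinarith

theorem LeadA.leadB (hβ : -1 < β) (hβ0 : β ≤ 0) (h : LeadA β i z) :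
    LeadB β (i + 1) (approach (profile i (i + 1)) z (timeA β i z)) := by
  have h1 := exp_neg_timeA h
  obtain ⟨h2, h3⟩ := h.gaps hβ hβ0 h.timeA_pos
  obtain ⟨a1, a2, a3⟩ := utilA_profile β i (i + 1)
  simp only [add_one_add_two] at a3
  have h4 : utilA β (approach (profile i (i + 1)) z (timeA β i z)) i =
      utilA β (approach (profile i (i + 1)) z (timeA β i z)) (i + 1) := by
    simp only [utilA_approach, a1, a3]
    linarith
  exact ⟨h3, by simpa [← h4] using h2, by simp [h4]⟩

/-- While B plays `i`, all utility gaps that define the profile `(i, i)` stay positive, except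
that the gap between `i` and `i + 1` for B vanishes at time `timeB`. -/
theorem LeadB.gaps (hβ0 : β ≤ 0) (h : LeadB β i z) {r : ℝ} (hr : 0 < r) :
    utilB β (approach (profile i i) z r) (i + 2) < utilB β (approach (profile i i) z r) i ∧
      StrictA β i (approach (profile i i) z r) := by
  have hlt : Real.exp (-r) < 1 := Real.exp_lt_one_iff.2 (by linarith)
  have hpos := Real.exp_pos (-r)
  obtain ⟨a1, a2, a3⟩ := utilA_profile β i i
  obtain ⟨b1, b2, b3⟩ := utilB_profile β i i
  obtain ⟨h1, h2, h3⟩ := h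
  rw [strictB_iff] at h1
  rw [strictA_iff]
  simp only [utilA_approach, utilB_approach, a1, a2, a3, b1, b3]
  refine ⟨?_, ?_, ?_⟩
  · nlinarith
  · nlinarith
  · nlinarith

theorem LeadB.strictB (hβ : -1 < β) (hβ0 : β ≤ 0) (h : LeadB β i z) {r : ℝ} (hr : 0 ≤ r)
    (hrT : r < timeB β i z) : StrictB β i (approach (profile i i) z r) := by
  rcases hr.eq_or_lt with rfl | hr
  · simpa [approach] using h.1
  have hlt : Real.exp (-timeB β i z) < Real.exp (-r) := Real.exp_lt_exp.2 (by linarith)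
  have h1 := exp_neg_timeB hβ h
  refine strictB_iff.2 ⟨?_, (h.gaps hβ0 hr).1⟩
  obtain ⟨b1, b2, b3⟩ := utilB_profile β i i
  have h2 := (strictB_iff.1 h.1).1
  simp only [utilB_approach, b1, b2]
  nlinarith

theorem LeadB.tie (hβ : -1 < β) (h : LeadB β i z) :
    utilB β (approach (profile i i) z (timeB β i z)) (i + 1) =
      utilB β (approach (profile i i) z (timeB β i z)) i := by
  have h1 := exp_neg_timeB hβ h
  obtain ⟨b1, b2, b3⟩ := utilB_profile β i i
  simp only [utilB_approach, b1, b2]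
  linarith

theorem LeadB.leadA (hβ : -1 < β) (hβ0 : β ≤ 0) (h : LeadB β i z) :
    LeadA β i (approach (profile i i) z (timeB β i z)) := by
  obtain ⟨h2, h3⟩ := h.gaps hβ0 (h.timeB_pos hβ)
  have h4 := h.tie hβ
  exact ⟨h3, by simpa [h4] using h2, h4.ge⟩

/-! ### Trajectories follow the phases -/

/-- A continuous induction principle: if `f < 0` before `r` implies `f r < 0`, then `f` stays
negative. -/
theorem forall_neg_of_first_zero {f : ℝ → ℝ} {T : ℝ} (hf : ContinuousOn f (Set.Icc 0 T))
    (h : ∀ r ∈ Set.Icc 0 T, (∀ r' ∈ Set.Ico 0 r, f r' < 0) → f r < 0) :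
    ∀ r ∈ Set.Icc 0 T, f r < 0 := by
  by_contra! hcon
  obtain ⟨r₀, hr₀, hfr₀⟩ := hcon
  have hK : IsCompact (Set.Icc 0 T ∩ f ⁻¹' Set.Ici 0) :=
    isCompact_Icc.of_isClosed_subset (hf.preimage_isClosed_of_isClosed isClosed_Icc isClosed_Ici)
      Set.inter_subset_left
  obtain ⟨m, ⟨hmT, hm0⟩, hm⟩ := hK.exists_isLeast ⟨r₀, hr₀, hfr₀⟩
  refine absurd (h m hmT fun r' hr' => ?_) (not_lt.2 hm0)
  by_contra! hr'f
  exact absurd (hm ⟨⟨hr'.1, hr'.2.le.trans hmT.2⟩, hr'f⟩) (not_le.2 hr'.2)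

theorem IsTrajectory.fst_eq_approach (hγ : IsTrajectory β γ) {s r : ℝ} (hs : 0 ≤ s) (hr : 0 ≤ r)
    (h : ∀ r' ∈ Set.Ioo 0 r, StrictA β i (γ (s + r'))) (j : Fin 3) :
    (γ (s + r)).1 = (approach (profile i j) (γ s) r).1 := by
  funext m
  have := hγ.eq_of_eq ((ContinuousLinearMap.proj m).comp
    (ContinuousLinearMap.fst ℝ (Fin 3 → ℝ) (Fin 3 → ℝ))) (c := (profile i j).1 m) (s := s)
    (t := s + r) hs (by linarith) fun t ht a ha b _ => by
      have h1 := h (t - s) ⟨by linarith [ht.1], by linarith [ht.2]⟩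
      rw [add_sub_cancel] at h1
      rw [eq_single_of_mem_bestResponse ha h1]
      rfl
  simpa [approach] using this

theorem IsTrajectory.snd_eq_approach (hγ : IsTrajectory β γ) {s r : ℝ} (hs : 0 ≤ s) (hr : 0 ≤ r)
    {j : Fin 3} (h : ∀ r' ∈ Set.Ioo 0 r, StrictB β j (γ (s + r'))) (i : Fin 3) :
    (γ (s + r)).2 = (approach (profile i j) (γ s) r).2 := by
  funext m
  have := hγ.eq_of_eq ((ContinuousLinearMap.proj m).comp
    (ContinuousLinearMap.snd ℝ (Fin 3 → ℝ) (Fin 3 → ℝ))) (c := (profile i j).2 m) (s := s)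
    (t := s + r) hs (by linarith) fun t ht a _ b hb => by
      have h1 := h (t - s) ⟨by linarith [ht.1], by linarith [ht.2]⟩
      rw [add_sub_cancel] at h1
      rw [eq_single_of_mem_bestResponse hb h1]
      rfl
  simpa [approach] using this

theorem IsTrajectory.continuousOn_shift (hγ : IsTrajectory β γ) {s : ℝ} (hs : 0 ≤ s) (T : ℝ) :
    ContinuousOn (fun r => γ (s + r)) (Set.Icc 0 T) :=
  hγ.continuousOn.comp (by fun_prop) fun r hr => add_nonneg hs hr.1

theorem IsTrajectory.eq_approach_of_leadA (hγ : IsTrajectory β γ) (hβ : -1 < β) (hβ0 : β ≤ 0)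
    {s : ℝ} (hs : 0 ≤ s) (h : LeadA β i (γ s)) {r : ℝ} (hr : 0 ≤ r)
    (hrT : r ≤ timeA β i (γ s)) :
    γ (s + r) = approach (profile i (i + 1)) (γ s) r := by
  have key : ∀ r, 0 ≤ r → (∀ r' ∈ Set.Ico 0 r, StrictA β i (γ (s + r'))) →
      γ (s + r) = approach (profile i (i + 1)) (γ s) r := by
    intro r hr hstrict
    refine Prod.ext (hγ.fst_eq_approach hs hr (fun r' hr' => hstrict r' ⟨hr'.1.le, hr'.2⟩) _) ?_
    refine hγ.snd_eq_approach hs hr (fun r' hr' => ?_) _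
    have h1 := hγ.fst_eq_approach hs hr'.1.le
      (fun t ht => hstrict t ⟨ht.1.le, ht.2.trans hr'.2⟩) (i + 1)
    have h2 := (h.gaps hβ hβ0 hr'.1).2
    unfold StrictB at h2 ⊢
    rwa [utilB_congr h1]
  have hstrict : ∀ r, 0 ≤ r → r < timeA β i (γ s) → StrictA β i (γ (s + r)) := by
    intro r hr hrT
    have hneg : ∀ r, StrictA β i (γ (s + r)) ↔
        max (utilA β (γ (s + r)) (i + 1) - utilA β (γ (s + r)) i)
          (utilA β (γ (s + r)) (i + 2) - utilA β (γ (s + r)) i) < 0 := by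
      intro r; rw [strictA_iff, max_lt_iff, sub_neg, sub_neg]
    have hc : ∀ m, ContinuousOn (fun r => utilA β (γ (s + r)) m) (Set.Icc 0 r) := fun m =>
      (continuous_utilA β m).comp_continuousOn (hγ.continuousOn_shift hs r)
    rw [hneg]
    refine forall_neg_of_first_zero
      (((hc (i + 1)).sub (hc i)).sup ((hc (i + 2)).sub (hc i))) (fun t ht ih => ?_) r
      ⟨hr, le_rfl⟩
    have htT := ht.2.trans_lt hrT
    refine (hneg t).1 ?_
    rw [key t ht.1 fun r' hr' => (hneg r').2 (ih r' hr')]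
    exact h.strictA hβ hβ0 ht.1 htT
  exact key r hr fun r' hr' => hstrict r' hr'.1 (hr'.2.trans_le hrT)

theorem IsTrajectory.eq_approach_of_leadB (hγ : IsTrajectory β γ) (hβ : -1 < β) (hβ0 : β ≤ 0)
    {s : ℝ} (hs : 0 ≤ s) (h : LeadB β i (γ s)) {r : ℝ} (hr : 0 ≤ r)
    (hrT : r ≤ timeB β i (γ s)) :
    γ (s + r) = approach (profile i i) (γ s) r := by
  have key : ∀ r, 0 ≤ r → (∀ r' ∈ Set.Ico 0 r, StrictB β i (γ (s + r'))) →
      γ (s + r) = approach (profile i i) (γ s) r := by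
    intro r hr hstrict
    refine Prod.ext ?_ (hγ.snd_eq_approach hs hr (fun r' hr' => hstrict r' ⟨hr'.1.le, hr'.2⟩) _)
    refine hγ.fst_eq_approach hs hr (fun r' hr' => ?_) _
    have h1 := hγ.snd_eq_approach hs hr'.1.le
      (fun t ht => hstrict t ⟨ht.1.le, ht.2.trans hr'.2⟩) i
    have h2 := (h.gaps hβ0 hr'.1).2
    unfold StrictA at h2 ⊢
    rwa [utilA_congr h1]
  have hstrict : ∀ r, 0 ≤ r → r < timeB β i (γ s) → StrictB β i (γ (s + r)) := by
    intro r hr hrT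
    have hneg : ∀ r, StrictB β i (γ (s + r)) ↔
        max (utilB β (γ (s + r)) (i + 1) - utilB β (γ (s + r)) i)
          (utilB β (γ (s + r)) (i + 2) - utilB β (γ (s + r)) i) < 0 := by
      intro r; rw [strictB_iff, max_lt_iff, sub_neg, sub_neg]
    have hc : ∀ m, ContinuousOn (fun r => utilB β (γ (s + r)) m) (Set.Icc 0 r) := fun m =>
      (continuous_utilB β m).comp_continuousOn (hγ.continuousOn_shift hs r)
    rw [hneg]
    refine forall_neg_of_first_zero
      (((hc (i + 1)).sub (hc i)).sup ((hc (i + 2)).sub (hc i))) (fun t ht ih => ?_) r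
      ⟨hr, le_rfl⟩
    have htT := ht.2.trans_lt hrT
    refine (hneg t).1 ?_
    rw [key t ht.1 fun r' hr' => (hneg r').2 (ih r' hr')]
    exact h.strictB hβ hβ0 ht.1 htT
  exact key r hr fun r' hr' => hstrict r' hr'.1 (hr'.2.trans_le hrT)

/-! ### Sections -/

/-- `z` lies on the section at which player B switches from `i` to `i + 1` while A plays `i`, and
its utility gaps are the coordinates of `v`. -/
def IsSection (β : ℝ) (i : Fin 3) (z : State) (v : Fin 3 → ℝ) : Prop :=
  utilA β z i - utilA β z (i + 1) = v 0 ∧ utilA β z i - utilA β z (i + 2) = v 1 ∧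
    utilB β z (i + 1) = utilB β z i ∧ utilB β z (i + 1) - utilB β z (i + 2) = v 2

/-- The length of the phase in which A keeps its strategy, in terms of the section vector. -/
noncomputable def durA (v : Fin 3 → ℝ) : ℝ := Real.log (1 + v 0)

/-- The length of the next phase, in which B keeps its strategy. -/
noncomputable def durB (β : ℝ) (v : Fin 3 → ℝ) : ℝ :=
  Real.log (1 + (v 0 + v 2) / (1 + v 0) / (1 + β))

/-- The state at the end of the first phase from a section. -/
noncomputable def midState (i : Fin 3) (z : State) (v : Fin 3 → ℝ) : State :=
  approach (profile i (i + 1)) z (durA v)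

/-- The state at the next section. -/
noncomputable def nextState (β : ℝ) (i : Fin 3) (z : State) (v : Fin 3 → ℝ) : State :=
  approach (profile (i + 1) (i + 1)) (midState i z v) (durB β v)

theorem LeadA.isSection (h : LeadA β i z) (htie : utilB β z (i + 1) = utilB β z i) :
    ∃ v, (∀ k, 0 < v k) ∧ IsSection β i z v := by
  have h1 := strictA_iff.1 h.1
  have h2 := h.2.1
  refine ⟨![utilA β z i - utilA β z (i + 1), utilA β z i - utilA β z (i + 2),
    utilB β z (i + 1) - utilB β z (i + 2)], fun k => ?_, rfl, rfl, htie, rfl⟩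
  fin_cases k <;> simp [h1, h2]

theorem IsSection.leadA (h : IsSection β i z v) (hv : ∀ k, 0 < v k) : LeadA β i z := by
  obtain ⟨h1, h2, h3, h4⟩ := h
  have := hv 0
  have := hv 1
  have := hv 2
  exact ⟨strictA_iff.2 ⟨by linarith, by linarith⟩, by linarith, h3.ge⟩

theorem IsSection.timeA_eq (h : IsSection β i z v) : timeA β i z = durA v := by
  rw [timeA, h.1, durA]

theorem durA_pos (hv : ∀ k, 0 < v k) : 0 < durA v := Real.log_pos (by linarith [hv 0])

theorem durB_pos (hβ : -1 < β) (hv : ∀ k, 0 < v k) : 0 < durB β v := by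
  have h0 := hv 0
  have h2 := hv 2
  exact Real.log_pos (lt_add_of_pos_right _ (div_pos (div_pos (by linarith) (by linarith))
    (by linarith)))

theorem exp_neg_durA (hv : ∀ k, 0 < v k) : Real.exp (-durA v) = (1 + v 0)⁻¹ := by
  rw [durA, Real.exp_neg, Real.exp_log (by linarith [hv 0])]

theorem exp_neg_durB (hβ : -1 < β) (hv : ∀ k, 0 < v k) : Real.exp (-durB β v) =
    (1 + v 0) * (1 + β) / (gapWeight β v + (1 + β)) := by
  have h0 := hv 0
  have h2 := hv 2
  have h1 : 0 < (v 0 + v 2) / (1 + v 0) / (1 + β) :=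
    div_pos (div_pos (by linarith) (by linarith)) (by linarith)
  have h3 : 1 + v 0 ≠ 0 := by linarith
  have h4 : 1 + β ≠ 0 := by linarith
  have h5 : (1 + v 0) * (1 + β) + (v 0 + v 2) ≠ 0 := by nlinarith
  have h6 : gapWeight β v + (1 + β) = (1 + v 0) * (1 + β) + (v 0 + v 2) := by
    simp only [gapWeight]; ring
  rw [durB, Real.exp_neg, Real.exp_log (by linarith), h6]
  field_simp

theorem IsSection.timeB_eq (h : IsSection β i z v) (hv : ∀ k, 0 < v k) :
    timeB β (i + 1) (midState i z v) = durB β v := by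
  have h0 := hv 0
  have h1 : 1 + v 0 ≠ 0 := by linarith
  obtain ⟨b1, b2, b3⟩ := utilB_profile β i (i + 1)
  have h2 : utilB β (midState i z v) (i + 1) - utilB β (midState i z v) (i + 2) =
      (v 0 + v 2) / (1 + v 0) := by
    rw [midState, utilB_approach, utilB_approach, b2, b3, exp_neg_durA hv, ← h.2.2.2]
    field_simp
    ring
  rw [timeB, durB, add_one_add_one, h2]

theorem IsSection.leadB (h : IsSection β i z v) (hv : ∀ k, 0 < v k) (hβ : -1 < β) (hβ0 : β ≤ 0) :
    LeadB β (i + 1) (midState i z v) := by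
  rw [midState, ← h.timeA_eq]
  exact (h.leadA hv).leadB hβ hβ0

/-- In terms of the gap vectors, the passage from a section to the next is `gapStep`. -/
theorem IsSection.next (h : IsSection β i z v) (hv : ∀ k, 0 < v k) (hβ : -1 < β) (hβ0 : β ≤ 0) :
    IsSection β (i + 1) (nextState β i z v) (gapStep β v) := by
  have htie := (h.leadB hv hβ hβ0).tie hβ
  rw [h.timeB_eq hv] at htie
  obtain ⟨h1, h2, h3, h4⟩ := h
  obtain ⟨a1, a2, a3⟩ := utilA_profile β i (i + 1)
  obtain ⟨b1, b2, b3⟩ := utilB_profile β i (i + 1)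
  obtain ⟨c1, c2, c3⟩ := utilA_profile β (i + 1) (i + 1)
  obtain ⟨d1, d2, d3⟩ := utilB_profile β (i + 1) (i + 1)
  simp only [add_one_add_one, add_one_add_two] at a2 a3 c2 c3 d2 d3
  have hw := gapWeight_pos hβ hv
  have hne : gapWeight β v + (1 + β) ≠ 0 := by linarith
  have hne' : 1 + v 0 ≠ 0 := by linarith [hv 0]
  refine ⟨?_, ?_, htie, ?_⟩
  · simp only [nextState, midState, utilA_approach, add_one_add_one, c1, c2, a1, a2,
      exp_neg_durA hv, exp_neg_durB hβ hv, gapStep, gapMatrix_mulVec, Pi.smul_apply, smul_eq_mul,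
      Matrix.cons_val_zero]
    have e1 : utilA β z (i + 1) = utilA β z i - v 0 := by linarith
    have e2 : utilA β z (i + 2) = utilA β z i - v 1 := by linarith
    rw [e1, e2]
    field_simp
    simp only [gapWeight]
    ring
  · simp only [nextState, midState, utilA_approach, add_one_add_two, c1, c3, a1, a3,
      exp_neg_durA hv, exp_neg_durB hβ hv, gapStep, gapMatrix_mulVec, Pi.smul_apply, smul_eq_mul,
      Matrix.cons_val_one, Matrix.cons_val_zero]
    have e1 : utilA β z (i + 1) = utilA β z i - v 0 := by linarith
    rw [e1]
    field_simp
    simp only [gapWeight]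
    ring
  · simp only [add_one_add_one, add_one_add_two] at htie ⊢
    simp only [nextState] at htie ⊢
    rw [htie]
    simp only [midState, utilB_approach, b1, b2, d1, d3,
      exp_neg_durA hv, exp_neg_durB hβ hv, gapStep, gapMatrix_mulVec, Pi.smul_apply, smul_eq_mul,
      Matrix.cons_val]
    rw [h3]
    field_simp
    simp only [gapWeight]
    ring

theorem IsTrajectory.eq_of_isSection (hγ : IsTrajectory β γ) (hβ : -1 < β) (hβ0 : β ≤ 0)
    {s : ℝ} (hs : 0 ≤ s) (h : IsSection β i (γ s) v) (hv : ∀ k, 0 < v k) :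
    (∀ r, 0 ≤ r → r ≤ durA v → γ (s + r) = approach (profile i (i + 1)) (γ s) r) ∧
    (∀ r, 0 ≤ r → r ≤ durB β v → γ (s + durA v + r) =
      approach (profile (i + 1) (i + 1)) (γ (s + durA v)) r) ∧
    IsSection β (i + 1) (γ (s + durA v + durB β v)) (gapStep β v) := by
  have hA := durA_pos hv
  have hB := durB_pos hβ hv
  have h1 : ∀ r, 0 ≤ r → r ≤ durA v → γ (s + r) = approach (profile i (i + 1)) (γ s) r :=
    fun r hr hrT => hγ.eq_approach_of_leadA hβ hβ0 hs (h.leadA hv) hr (h.timeA_eq ▸ hrT)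
  have hmid : γ (s + durA v) = midState i (γ s) v := h1 _ hA.le le_rfl
  have h2 : ∀ r, 0 ≤ r → r ≤ durB β v → γ (s + durA v + r) =
      approach (profile (i + 1) (i + 1)) (γ (s + durA v)) r := fun r hr hrT =>
    hγ.eq_approach_of_leadB hβ hβ0 (by linarith) (hmid ▸ h.leadB hv hβ hβ0) hr
      (by rw [hmid, h.timeB_eq hv]; exact hrT)
  refine ⟨h1, h2, ?_⟩
  rw [h2 _ hB.le le_rfl, hmid]
  exact h.next hv hβ hβ0

/-! ### Entering the Shapley cycle -/

/-- `i` is a best response of player A and `i + 2` one of player B: the state is in the closed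
region of one of the three profiles outside the Shapley cycle. -/
def OffCycle (β : ℝ) (i : Fin 3) (x : State) : Prop :=
  (∀ m, utilA β x m ≤ utilA β x i) ∧ ∀ m, utilB β x m ≤ utilB β x (i + 2)

/-- Outside the off-cycle regions, the state is in one of the six phases of the Shapley cycle. -/
theorem exists_lead_of_not_offCycle {x : State} (h : ∀ i, ¬ OffCycle β i x) :
    ∃ i, LeadA β i x ∨ LeadB β i x := by
  obtain ⟨i, hi⟩ := Finite.exists_max (utilA β x)
  obtain ⟨j, hj⟩ := Finite.exists_max (utilB β x)
  have hA := (forall_fin i).1 hi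
  -- The case in which `i + 1` is a best response of player B.
  have key : (∀ m, utilB β x m ≤ utilB β x (i + 1)) → ∃ i, LeadA β i x ∨ LeadB β i x := by
    intro hB
    have hB' := (forall_fin i).1 hB
    have h1 : utilB β x (i + 2) < utilB β x (i + 1) := by
      by_contra! hle
      exact h i ⟨hi, fun m => (hB m).trans hle⟩
    have h2 : utilA β x (i + 2) < utilA β x i := by
      by_contra! hle
      exact h (i + 2) ⟨fun m => (hi m).trans hle, by simpa using hB⟩
    rcases hA.2.1.lt_or_eq with h3 | h3
    · exact ⟨i, Or.inl ⟨strictA_iff.2 ⟨h3, h2⟩, h1, hB'.1⟩⟩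
    · have h4 : utilB β x i < utilB β x (i + 1) := by
        by_contra! hle
        refine h (i + 1) ⟨fun m => (hi m).trans h3.ge, fun m => ?_⟩
        simpa using (hB m).trans hle
      refine ⟨i + 1, Or.inr ⟨strictB_iff.2 ?_, ?_, ?_⟩⟩
      · simpa using ⟨h1, h4⟩
      · simpa [h3] using h2
      · simp [h3]
  have hj' : j = i ∨ j = i + 1 ∨ j = i + 2 := by
    have : ∀ i j : Fin 3, j = i ∨ j = i + 1 ∨ j = i + 2 := by decide
    exact this i j
  rcases hj' with rfl | rfl | rfl
  · by_cases hB : utilB β x j ≤ utilB β x (j + 1)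
    · exact key fun m => (hj m).trans hB
    · have h1 : utilB β x (j + 2) < utilB β x j := by
        by_contra! hle
        exact h j ⟨hi, fun m => (hj m).trans hle⟩
      have h2 : utilA β x (j + 1) < utilA β x j := by
        by_contra! hle
        exact h (j + 1) ⟨fun m => (hi m).trans hle, by simpa using hj⟩
      exact ⟨j, Or.inr ⟨strictB_iff.2 ⟨not_le.1 hB, h1⟩, h2, hA.2.2⟩⟩
  · exact key hj
  · exact absurd ⟨hi, hj⟩ (h i)

theorem IsTrajectory.exists_isSection (hγ : IsTrajectory β γ) (hβ : -1 < β) (hβ0 : β ≤ 0)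
    {t : ℝ} (ht : 0 ≤ t) (h : ∀ i, ¬ OffCycle β i (γ t)) :
    ∃ s i v, 0 ≤ s ∧ (∀ k, 0 < v k) ∧ IsSection β i (γ s) v := by
  have fromB : ∀ {t i}, 0 ≤ t → LeadB β i (γ t) →
      ∃ s i v, 0 ≤ s ∧ (∀ k, 0 < v k) ∧ IsSection β i (γ s) v := by
    intro t i ht hB
    have hT := hB.timeB_pos hβ
    have h1 := hγ.eq_approach_of_leadB hβ hβ0 ht hB hT.le le_rfl
    obtain ⟨v, hv, hs⟩ := (hB.leadA hβ hβ0).isSection (hB.tie hβ)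
    exact ⟨t + timeB β i (γ t), i, v, by linarith, hv, h1 ▸ hs⟩
  obtain ⟨i, hA | hB⟩ := exists_lead_of_not_offCycle h
  · have hT := hA.timeA_pos
    have h1 := hγ.eq_approach_of_leadA hβ hβ0 ht hA hT.le le_rfl
    exact fromB (t := t + timeA β i (γ t)) (by linarith) (h1 ▸ hA.leadB hβ hβ0)
  · exact fromB ht hB

/-! ### Section states are determined by their gaps -/

theorem snd_eq_utilA (β : ℝ) (x : State) (i : Fin 3) : (1 + β ^ 3) * x.2 i =
    utilA β x i - β * utilA β x (i + 2) + β ^ 2 * utilA β x (i + 1) := by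
  simp only [utilA_apply, add_two_add_two, add_one_add_two]; ring

theorem fst_eq_utilB (β : ℝ) (x : State) (i : Fin 3) : (1 - β ^ 3) * x.1 i =
    utilB β x (i + 1) + β * utilB β x (i + 2) + β ^ 2 * utilB β x i := by
  simp only [utilB_apply, add_two_add_two, add_one_add_two]; ring

theorem one_add_cube_pos (hβ : -1 < β) : 0 < 1 + β ^ 3 := by
  nlinarith [sq_nonneg β, sq_nonneg (β - 1), mul_pos (by linarith : 0 < 1 + β)
    (by nlinarith [sq_nonneg (2 * β - 1)] : 0 < 1 - β + β ^ 2)]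

theorem one_sub_cube_pos (hβ0 : β ≤ 0) : 0 < 1 - β ^ 3 := by
  nlinarith [sq_nonneg β, mul_nonneg (sq_nonneg β) (neg_nonneg.2 hβ0)]

theorem sum_utilA {x : State} (h : ∑ m, x.2 m = 1) (i : Fin 3) :
    utilA β x i + utilA β x (i + 1) + utilA β x (i + 2) = 1 + β := by
  have := sum_shift x.2 i
  simp only [utilA_apply, add_two_add_two, add_one_add_two]
  linear_combination (1 + β) * (this.trans h)

theorem sum_utilB {x : State} (h : ∑ m, x.1 m = 1) (i : Fin 3) :
    utilB β x i + utilB β x (i + 1) + utilB β x (i + 2) = 1 - β := by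
  have := sum_shift x.1 i
  simp only [utilB_apply, add_two_add_two, add_one_add_two]
  linear_combination (1 - β) * (this.trans h)

/-- The state on section `0` with gap vector `v`. The gaps, together with the sums `1 + β` and
`1 - β` of the utilities, determine the utilities `uA` and `uB`, and the payoff matrices are then
inverted. -/
noncomputable def baseState (β : ℝ) (v : Fin 3 → ℝ) : State :=
  let uA : Fin 3 → ℝ := ![(1 + β + v 0 + v 1) / 3, (1 + β - 2 * v 0 + v 1) / 3,
    (1 + β + v 0 - 2 * v 1) / 3]
  let uB : Fin 3 → ℝ := ![(1 - β + v 2) / 3, (1 - β + v 2) / 3, (1 - β - 2 * v 2) / 3]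
  (fun m => (uB (m + 1) + β * uB (m + 2) + β ^ 2 * uB m) / (1 - β ^ 3),
    fun m => (uA m - β * uA (m + 2) + β ^ 2 * uA (m + 1)) / (1 + β ^ 3))

/-- The simultaneous cyclic relabelling of the strategies of both players. -/
def rot (k : Fin 3) (x : State) : State := (fun m => x.1 (m - k), fun m => x.2 (m - k))

theorem utilA_rot (β : ℝ) (k : Fin 3) (x : State) (m : Fin 3) :
    utilA β (rot k x) (m + k) = utilA β x m := by
  simp only [utilA_apply, rot, add_sub_cancel_right, add_right_comm m k 2]

theorem utilB_rot (β : ℝ) (k : Fin 3) (x : State) (m : Fin 3) :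
    utilB β (rot k x) (m + k) = utilB β x m := by
  simp only [utilB_apply, rot, add_sub_cancel_right, add_right_comm m k 2]

theorem continuous_rot (k : Fin 3) : Continuous (rot k) := by
  unfold rot
  fun_prop

theorem isSection_rot (k : Fin 3) : IsSection β (i + k) (rot k z) v ↔ IsSection β i z v := by
  have h1 : i + k + 1 = i + 1 + k := add_right_comm _ _ _
  have h2 : i + k + 2 = i + 2 + k := add_right_comm _ _ _
  simp only [IsSection, h1, h2, utilA_rot, utilB_rot]

theorem sum_rot (f : Fin 3 → ℝ) (k : Fin 3) : ∑ m, f (m - k) = ∑ m, f m :=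
  (Equiv.subRight k).sum_comp f

theorem sum_baseState (hβ : -1 < β) (hβ0 : β ≤ 0) (v : Fin 3 → ℝ) :
    ∑ m, (baseState β v).1 m = 1 ∧ ∑ m, (baseState β v).2 m = 1 := by
  have h1 := (one_add_cube_pos hβ).ne'
  have h2 := (one_sub_cube_pos hβ0).ne'
  constructor
  · simp [Fin.sum_univ_three, baseState]
    field_simp
    ring
  · simp [Fin.sum_univ_three, baseState]
    field_simp
    ring

theorem isSection_baseState (hβ : -1 < β) (hβ0 : β ≤ 0) (v : Fin 3 → ℝ) :
    IsSection β 0 (baseState β v) v := by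
  have h1 := (one_add_cube_pos hβ).ne'
  have h2 := (one_sub_cube_pos hβ0).ne'
  refine ⟨?_, ?_, ?_, ?_⟩ <;> simp [utilA_apply, utilB_apply, baseState] <;> field_simp <;> ring

theorem continuous_baseState (β : ℝ) : Continuous (baseState β) := by
  unfold baseState
  refine Continuous.prodMk (continuous_pi fun m => ?_) (continuous_pi fun m => ?_)
  · fin_cases m <;> simp <;> fun_prop
  · fin_cases m <;> simp <;> fun_prop

/-- A section state is determined by its index and its gap vector. -/
theorem IsSection.ext {x y : State} (hβ : -1 < β) (hβ0 : β ≤ 0) (hx : IsSection β i x v)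
    (hy : IsSection β i y v) (hx1 : ∑ m, x.1 m = 1) (hx2 : ∑ m, x.2 m = 1)
    (hy1 : ∑ m, y.1 m = 1) (hy2 : ∑ m, y.2 m = 1) : x = y := by
  obtain ⟨a1, a2, a3, a4⟩ := hx
  obtain ⟨b1, b2, b3, b4⟩ := hy
  have sA := sum_utilA (β := β) hx2 i
  have sA' := sum_utilA (β := β) hy2 i
  have sB := sum_utilB (β := β) hx1 i
  have sB' := sum_utilB (β := β) hy1 i
  have hA : ∀ m, utilA β x m = utilA β y m :=
    (forall_fin i).2 ⟨by linarith, by linarith, by linarith⟩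
  have hB : ∀ m, utilB β x m = utilB β y m :=
    (forall_fin i).2 ⟨by linarith, by linarith, by linarith⟩
  refine Prod.ext (funext fun m => ?_) (funext fun m => ?_)
  · refine mul_left_cancel₀ (one_sub_cube_pos hβ0).ne' ?_
    simp only [fst_eq_utilB, hB]
  · refine mul_left_cancel₀ (one_add_cube_pos hβ).ne' ?_
    simp only [snd_eq_utilA, hA]

theorem IsSection.eq_rot_baseState (hβ : -1 < β) (hβ0 : β ≤ 0) (h : IsSection β i z v)
    (h1 : ∑ m, z.1 m = 1) (h2 : ∑ m, z.2 m = 1) : z = rot i (baseState β v) := by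
  obtain ⟨s1, s2⟩ := sum_baseState hβ hβ0 v
  refine h.ext hβ hβ0 ?_ h1 h2 ((sum_rot _ _).trans s1) ((sum_rot _ _).trans s2)
  have := (isSection_rot (i := 0) i).2 (isSection_baseState hβ hβ0 v)
  rwa [zero_add] at this

theorem IsTrajectory.eq_rot_baseState (hγ : IsTrajectory β γ) (hβ : -1 < β) (hβ0 : β ≤ 0)
    {s : ℝ} (hs : 0 ≤ s) (h : IsSection β i (γ s) v) : γ s = rot i (baseState β v) :=
  h.eq_rot_baseState hβ hβ0 (hγ.mem_phaseSpace s hs).1.2 (hγ.mem_phaseSpace s hs).2.2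

/-! ### Comparing two trajectories in the Shapley cycle -/

theorem dist_approach_le (E x y : State) {r : ℝ} (hr : 0 ≤ r) :
    dist (approach E x r) (approach E y r) ≤ dist x y := by
  rw [approach, approach, dist_add_right, dist_smul₀, Real.norm_of_nonneg (Real.exp_pos _).le]
  exact mul_le_of_le_one_left dist_nonneg (exp_neg_mem hr).1

/-- Two trajectories on which the same profile is played for times `T` and `T'` stay close. -/
theorem IsTrajectory.dist_le_of_approach (hγ : IsTrajectory β γ) {E : State} {s s' T T' : ℝ}
    (hs : 0 ≤ s) (hT' : 0 ≤ T')
    (h : ∀ r, 0 ≤ r → r ≤ T → γ (s + r) = approach E (γ s) r)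
    (h' : ∀ r, 0 ≤ r → r ≤ T' → g (s' + r) = approach E (g s') r) {r : ℝ} (hr : 0 ≤ r)
    (hrT : r ≤ T) :
    dist (γ (s + r)) (g (s' + min r T')) ≤ dist (γ s) (g s') + |T - T'| := by
  have hm : 0 ≤ min r T' := le_min hr hT'
  have hmr := min_le_left r T'
  have h1 : dist (γ (s + r)) (γ (s + min r T')) ≤ |T - T'| := by
    refine (hγ.dist_le_of_le (by linarith) (by linarith)).trans ?_
    rcases min_cases r T' with ⟨e, _⟩ | ⟨e, _⟩ <;> rw [e]
    · simp
    · exact le_trans (by linarith) (le_abs_self _)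
  have h2 : dist (γ (s + min r T')) (g (s' + min r T')) ≤ dist (γ s) (g s') := by
    rw [h _ hm (hmr.trans hrT), h' _ hm (min_le_right _ _)]
    exact dist_approach_le _ _ _ hm
  linarith [dist_triangle (γ (s + r)) (γ (s + min r T')) (g (s' + min r T'))]

/-- The residue of `n` modulo `3`, the index of the `n`-th section of the Shapley cycle. -/
def idx (n : ℕ) : Fin 3 := Fin.ofNat 3 n

theorem idx_succ (n : ℕ) : idx (n + 1) = idx n + 1 := by
  ext
  simp [idx, Fin.val_add]

theorem idx_val_add (i : Fin 3) (n : ℕ) : idx (i.val + n) = i + idx n := by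
  ext
  simp [idx, Fin.val_add]

@[simp] theorem idx_zero : idx 0 = 0 := rfl

/-- The successive section times of a trajectory that passes a section with gaps `v` at time `s`. -/
noncomputable def sectionTime (β s : ℝ) (v : Fin 3 → ℝ) : ℕ → ℝ
  | 0 => s
  | n + 1 => sectionTime β s v n + durA ((gapStep β)^[n] v) + durB β ((gapStep β)^[n] v)

theorem iterate_gapStep_pos (hβ : -1 < β) (hβ0 : β ≤ 0) (hv : ∀ k, 0 < v k) (n : ℕ) :
    ∀ k, 0 < (gapStep β)^[n] v k := by
  induction n with
  | zero => exact hv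
  | succ n ih => rw [Function.iterate_succ_apply']; exact gapStep_pos hβ hβ0 ih

theorem sectionTime_strictMono (hβ : -1 < β) (hβ0 : β ≤ 0) (s : ℝ) (hv : ∀ k, 0 < v k) :
    StrictMono (sectionTime β s v) := strictMono_nat_of_lt_succ fun n => by
  have h := iterate_gapStep_pos hβ hβ0 hv n
  have := durA_pos h
  have := durB_pos hβ h
  rw [sectionTime]
  linarith

theorem IsTrajectory.isSection_sectionTime (hγ : IsTrajectory β γ) (hβ : -1 < β) (hβ0 : β ≤ 0)
    {s : ℝ} (hs : 0 ≤ s) (h : IsSection β i (γ s) v) (hv : ∀ k, 0 < v k) (n : ℕ) :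
    IsSection β (i + idx n) (γ (sectionTime β s v n)) ((gapStep β)^[n] v) := by
  induction n with
  | zero => simpa [sectionTime] using h
  | succ n ih =>
    have h0 : 0 ≤ sectionTime β s v n :=
      hs.trans ((sectionTime_strictMono hβ hβ0 s hv).monotone (Nat.zero_le n))
    have := (hγ.eq_of_isSection hβ hβ0 h0 ih (iterate_gapStep_pos hβ hβ0 hv n)).2.2
    rw [Function.iterate_succ_apply', idx_succ, ← add_assoc]
    exact this

theorem tendsto_durA (hw : ∀ k, 0 < w k) {u : ℕ → Fin 3 → ℝ} (hu : Tendsto u atTop (𝓝 w)) :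
    Tendsto (fun n => durA (u n)) atTop (𝓝 (durA w)) := by
  have h0 := tendsto_pi_nhds.1 hu 0
  exact (h0.const_add 1).log (by linarith [hw 0])

theorem tendsto_durB (hβ : -1 < β) (hw : ∀ k, 0 < w k) {u : ℕ → Fin 3 → ℝ}
    (hu : Tendsto u atTop (𝓝 w)) : Tendsto (fun n => durB β (u n)) atTop (𝓝 (durB β w)) := by
  have h0 := tendsto_pi_nhds.1 hu 0
  have h2 := tendsto_pi_nhds.1 hu 2
  have p0 := hw 0
  have p2 := hw 2
  refine ((((h0.add h2).div (h0.const_add 1) (by linarith)).div_const (1 + β)).const_add 1).log ?_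
  have : 0 < (w 0 + w 2) / (1 + w 0) / (1 + β) :=
    div_pos (div_pos (by linarith) (by linarith)) (by linarith)
  linarith

theorem tendsto_sectionTime (hβ : -1 < β) (hβ0 : β ≤ 0) (s : ℝ) (hv : ∀ k, 0 < v k)
    (hw : ∀ k, 0 < w k) (hlim : Tendsto (fun n => (gapStep β)^[n] v) atTop (𝓝 w)) :
    Tendsto (sectionTime β s v) atTop atTop := by
  have hd := half_lt_self (durA_pos hw)
  obtain ⟨N, hN⟩ := ((tendsto_durA hw hlim).eventually (lt_mem_nhds hd)).exists_forall_of_atTop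
  have key : ∀ k : ℕ, sectionTime β s v N + k * (durA w / 2) ≤ sectionTime β s v (k + N) := by
    intro k
    induction k with
    | zero => simp
    | succ k ih =>
      have h1 := hN (k + N) (Nat.le_add_left _ _)
      have h2 := durB_pos hβ (iterate_gapStep_pos hβ hβ0 hv (k + N))
      rw [Nat.succ_add, sectionTime]
      push_cast
      linarith
  refine (tendsto_add_atTop_iff_nat N).1 (tendsto_atTop_mono key ?_)
  exact tendsto_atTop_add_const_left _ _
    (tendsto_natCast_atTop_atTop.atTop_mul_const (half_pos (durA_pos hw)))

/-- A bound, in terms of section vectors, for the distance of two trajectories between sections. -/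
noncomputable def sectionDist (β : ℝ) (v w : Fin 3 → ℝ) : ℝ :=
  ∑ i, dist (rot i (baseState β v)) (rot i (baseState β w)) + 2 * |durA v - durA w| +
    |durB β v - durB β w|

theorem tendsto_sectionDist (hβ : -1 < β) (hw : ∀ k, 0 < w k) {u : ℕ → Fin 3 → ℝ}
    (hu : Tendsto u atTop (𝓝 w)) : Tendsto (fun n => sectionDist β (u n) w) atTop (𝓝 0) := by
  have h1 : Tendsto (fun n => ∑ i, dist (rot i (baseState β (u n))) (rot i (baseState β w)))
      atTop (𝓝 (∑ _i : Fin 3, (0 : ℝ))) := tendsto_finsetSum _ fun i _ =>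
    tendsto_iff_dist_tendsto_zero.1
      ((((continuous_rot i).comp (continuous_baseState β)).tendsto w).comp hu)
  have h2 := tendsto_iff_dist_tendsto_zero.1 (tendsto_durA hw hu)
  have h3 := tendsto_iff_dist_tendsto_zero.1 (tendsto_durB hβ hw hu)
  simpa [Real.dist_eq, sectionDist] using (h1.add (h2.const_mul 2)).add h3

theorem sectionDist_comm (β : ℝ) (v w : Fin 3 → ℝ) : sectionDist β v w = sectionDist β w v := by
  simp only [sectionDist, dist_comm, abs_sub_comm]

/-- Between two sections, a trajectory is close to a trajectory that starts on the same section. -/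
theorem IsTrajectory.exists_dist_le (hγ : IsTrajectory β γ) (hg : IsTrajectory β g) (hβ : -1 < β)
    (hβ0 : β ≤ 0) {s s' : ℝ} (hs : 0 ≤ s) (hs' : 0 ≤ s') (h : IsSection β i (γ s) v)
    (h' : IsSection β i (g s') w) (hv : ∀ k, 0 < v k) (hw : ∀ k, 0 < w k) {t : ℝ} (hst : s ≤ t)
    (ht : t ≤ s + durA v + durB β v) : ∃ t' ∈ Set.Ici 0, dist (γ t) (g t') ≤ sectionDist β v w := by
  obtain ⟨a1, a2, _⟩ := hγ.eq_of_isSection hβ hβ0 hs h hv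
  obtain ⟨b1, b2, _⟩ := hg.eq_of_isSection hβ hβ0 hs' h' hw
  have hAv := durA_pos hv
  have hAw := durA_pos hw
  have hBw := durB_pos hβ hw
  have h0 : dist (γ s) (g s') ≤
      ∑ i, dist (rot i (baseState β v)) (rot i (baseState β w)) := by
    rw [hγ.eq_rot_baseState hβ hβ0 hs h, hg.eq_rot_baseState hβ hβ0 hs' h']
    exact Finset.single_le_sum
      (f := fun i => dist (rot i (baseState β v)) (rot i (baseState β w)))
      (fun _ _ => dist_nonneg) (Finset.mem_univ i)
  have n1 := abs_nonneg (durA v - durA w)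
  have n2 := abs_nonneg (durB β v - durB β w)
  rcases le_total t (s + durA v) with htA | htA
  · have := hγ.dist_le_of_approach hs hAw.le a1 b1 (r := t - s) (by linarith) (by linarith)
    rw [add_sub_cancel] at this
    exact ⟨_, add_nonneg hs' (le_min (by linarith) hAw.le), this.trans (by
      unfold sectionDist; linarith)⟩
  · have h1 := hγ.dist_le_of_approach hs hAw.le a1 b1 hAv.le le_rfl
    have h2 : dist (g (s' + min (durA v) (durA w))) (g (s' + durA w)) ≤
        |durA v - durA w| := by
      rw [dist_comm]
      refine (hg.dist_le_of_le (add_nonneg hs' (le_min hAv.le hAw.le))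
        (by linarith [min_le_right (durA v) (durA w)])).trans ?_
      rcases min_cases (durA v) (durA w) with ⟨e, _⟩ | ⟨e, _⟩ <;> rw [e]
      · rw [abs_sub_comm]
        exact le_trans (by linarith) (le_abs_self _)
      · simp
    have h3 := dist_triangle (γ (s + durA v)) (g (s' + min (durA v) (durA w))) (g (s' + durA w))
    have h4 := hγ.dist_le_of_approach (by linarith) hBw.le a2 b2 (r := t - (s + durA v))
      (by linarith) (by linarith)
    rw [add_sub_cancel] at h4
    exact ⟨_, add_nonneg (by linarith) (le_min (by linarith) hBw.le), h4.trans (by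
      unfold sectionDist; linarith)⟩

theorem exists_mem_Icc_of_tendsto {τ : ℕ → ℝ} (hτ : Tendsto τ atTop atTop) {N : ℕ} {t : ℝ}
    (ht : τ N ≤ t) : ∃ n, N ≤ n ∧ τ n ≤ t ∧ t ≤ τ (n + 1) := by
  by_contra! h
  have : ∀ k, τ (N + k) ≤ t := by
    intro k
    induction k with
    | zero => exact ht
    | succ k ih => exact (h (N + k) (Nat.le_add_right _ _) ih).le
  obtain ⟨n, hn, hn'⟩ :=
    ((eventually_ge_atTop N).and (hτ.eventually (eventually_gt_atTop t))).exists
  obtain ⟨k, rfl⟩ := Nat.exists_eq_add_of_le hn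
  exact absurd (this k) (not_le.2 hn')

theorem sectionTime_fixed (hw : gapStep β w = w) (s : ℝ) (n : ℕ) :
    sectionTime β s w n = s + n * (durA w + durB β w) := by
  induction n with
  | zero => simp [sectionTime]
  | succ n ih =>
    rw [sectionTime, ih, Function.iterate_fixed hw]
    push_cast
    ring

/-- A trajectory that passes a section tends to the orbit whose gap vector `w` at the sections is
the fixed point of the section map. -/
theorem tendsto_infDist_of_isSection
    (hγ : IsTrajectory β γ) (hg : IsTrajectory β g) (hβ : -1 < β) (hβ0 : β ≤ 0) {s : ℝ}
    (hs : 0 ≤ s) (h : IsSection β i (γ s) v) (hv : ∀ k, 0 < v k) (hw : ∀ k, 0 < w k)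
    (hfix : gapMatrix β *ᵥ w = (gapWeight β w + (1 + β)) • w) (h' : IsSection β 0 (g 0) w) :
    Tendsto (fun t => Metric.infDist (γ t) (g '' Set.Ici 0)) atTop (𝓝 0) := by
  have hlim := tendsto_iterate_gapStep hβ hβ0 hw hfix hv
  have hgfix := gapStep_fixed hβ hw hfix
  have hmono := sectionTime_strictMono hβ hβ0 s hv
  rw [Metric.tendsto_atTop]
  intro ε hε
  obtain ⟨N, hN⟩ := ((tendsto_sectionDist hβ hw hlim).eventually
    (gt_mem_nhds hε)).exists_forall_of_atTop
  refine ⟨sectionTime β s v N, fun t ht => ?_⟩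
  obtain ⟨n, hn, h1, h2⟩ := exists_mem_Icc_of_tendsto (tendsto_sectionTime hβ hβ0 s hv hw hlim) ht
  have hpos := hs.trans (hmono.monotone (Nat.zero_le n) : s ≤ _)
  have hsec := hγ.isSection_sectionTime hβ hβ0 hs h hv n
  have hsec' := hg.isSection_sectionTime hβ hβ0 le_rfl h' hw (i.val + n)
  rw [Function.iterate_fixed hgfix, zero_add, idx_val_add] at hsec'
  obtain ⟨t', ht', hd⟩ := hγ.exists_dist_le hg hβ hβ0 hpos
    ((sectionTime_strictMono hβ hβ0 0 hw).monotone (Nat.zero_le _)) hsec hsec'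
    (iterate_gapStep_pos hβ hβ0 hv n) hw h1 h2
  rw [Real.dist_eq, sub_zero, abs_of_nonneg Metric.infDist_nonneg]
  exact ((Metric.infDist_le_dist_of_mem (Set.mem_image_of_mem _ ht')).trans hd).trans_lt (hN n hn)

/-- The closed orbit with gap vector `w` lies in the closure of the points of every trajectory that
passes a section. -/
theorem infDist_eq_zero_of_isSection
    (hγ : IsTrajectory β γ) (hg : IsTrajectory β g) (hβ : -1 < β) (hβ0 : β ≤ 0) {s : ℝ}
    (hs : 0 ≤ s) (h : IsSection β i (γ s) v) (hv : ∀ k, 0 < v k) (hw : ∀ k, 0 < w k)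
    (hfix : gapMatrix β *ᵥ w = (gapWeight β w + (1 + β)) • w) (h' : IsSection β 0 (g 0) w)
    (hper : ∀ t, 0 ≤ t → g (t + 3 * (durA w + durB β w)) = g t) {t : ℝ} (ht : 0 ≤ t) :
    Metric.infDist (g t) (γ '' Set.Ici 0) = 0 := by
  have hlim := tendsto_iterate_gapStep hβ hβ0 hw hfix hv
  have hgfix := gapStep_fixed hβ hw hfix
  have hmono := sectionTime_strictMono hβ hβ0 s hv
  have hθ : 0 < durA w + durB β w := add_pos (durA_pos hw) (durB_pos hβ hw)
  set θ := durA w + durB β w with hθdef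
  have htend : Tendsto (sectionTime β 0 w) atTop atTop :=
    tendsto_sectionTime hβ hβ0 0 hw hw (by
      simp only [Function.iterate_fixed hgfix]; exact tendsto_const_nhds)
  obtain ⟨n₁, -, hn1, hn2⟩ := exists_mem_Icc_of_tendsto htend (N := 0) (t := t) ht
  -- The sections of `g` that have the right index return every three steps.
  have key : ∀ m : ℕ, Metric.infDist (g t) (γ '' Set.Ici 0) ≤
      sectionDist β ((gapStep β)^[n₁ + 3 * (m + 1) - i.val] v) w := by
    intro m
    have hi := i.isLt
    set n := n₁ + 3 * (m + 1) - i.val with hn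
    have hn' : i.val + n = n₁ + 3 * (m + 1) := by omega
    have hpos := hs.trans (hmono.monotone (Nat.zero_le n) : s ≤ _)
    have hsec := hγ.isSection_sectionTime hβ hβ0 hs h hv n
    have hsec' := hg.isSection_sectionTime hβ hβ0 le_rfl h' hw (i.val + n)
    rw [Function.iterate_fixed hgfix, zero_add, idx_val_add] at hsec'
    have e1 := sectionTime_fixed hgfix 0 (i.val + n)
    have e2 := sectionTime_fixed hgfix 0 n₁
    have e3 := sectionTime_fixed hgfix 0 (n₁ + 1)
    rw [e2] at hn1
    rw [e3] at hn2
    rw [hn'] at e1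
    rw [hn', e1] at hsec'
    push_cast at hn2 hsec'
    rw [← hθdef] at hn1 hn2 hsec'
    obtain ⟨t', ht', hd⟩ := hg.exists_dist_le hγ hβ hβ0 (by positivity) hpos hsec' hsec hw
      (iterate_gapStep_pos hβ hβ0 hv n) (t := t + (m + 1 : ℕ) * (3 * θ))
      (by push_cast; linarith) (by push_cast; linarith)
    rw [eq_of_periodic (by positivity) hper (m + 1) ht, sectionDist_comm] at hd
    exact (Metric.infDist_le_dist_of_mem (Set.mem_image_of_mem _ ht')).trans hd
  refine le_antisymm (ge_of_tendsto' (x := atTop) ?_ key) Metric.infDist_nonneg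
  refine tendsto_sectionDist hβ hw (hlim.comp (tendsto_atTop_mono (fun m => ?_) tendsto_id))
  have hi := i.isLt
  simp only [id]
  omega

/-! ### The Shapley orbit -/

theorem approach_zero (E z : State) : approach E z 0 = z := by simp [approach]

theorem rot_profile (i j k : Fin 3) : rot k (profile i j) = profile (i + k) (j + k) := by
  refine Prod.ext (funext fun m => ?_) (funext fun m => ?_) <;>
    simp [rot, profile, Pi.single_apply, sub_eq_iff_eq_add]

theorem rot_approach (k : Fin 3) (E z : State) (r : ℝ) :
    rot k (approach E z r) = approach (rot k E) (rot k z) r := rfl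

theorem rot_rot (j k : Fin 3) (x : State) : rot j (rot k x) = rot (k + j) x := by
  simp only [rot, sub_sub, add_comm j k]

theorem rot_mem_phaseSpace (k : Fin 3) (h : z ∈ phaseSpace) : rot k z ∈ phaseSpace :=
  ⟨⟨fun m => h.1.1 (m - k), (sum_rot _ _).trans h.1.2⟩,
    ⟨fun m => h.2.1 (m - k), (sum_rot _ _).trans h.2.2⟩⟩

theorem profile_mem_phaseSpace (i j : Fin 3) : profile i j ∈ phaseSpace :=
  ⟨single_mem_stdSimplex ℝ i, single_mem_stdSimplex ℝ j⟩

theorem convex_phaseSpace : Convex ℝ phaseSpace :=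
  (convex_stdSimplex ℝ (Fin 3)).prod (convex_stdSimplex ℝ (Fin 3))

theorem approach_mem_phaseSpace {E : State} (hE : E ∈ phaseSpace) (hz : z ∈ phaseSpace) {r : ℝ}
    (hr : 0 ≤ r) : approach E z r ∈ phaseSpace :=
  convex_phaseSpace hz hE (Real.exp_pos _).le (sub_nonneg.2 (exp_neg_mem hr).1) (by ring)

theorem dist_le_one_of_mem_phaseSpace {x y : State} (hx : x ∈ phaseSpace) (hy : y ∈ phaseSpace) :
    dist x y ≤ 1 := by
  rw [Prod.dist_eq, max_le_iff, dist_pi_le_iff zero_le_one, dist_pi_le_iff zero_le_one]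
  constructor <;> intro m
  · have h1 := mem_Icc_of_mem_stdSimplex hx.1 m
    have h2 := mem_Icc_of_mem_stdSimplex hy.1 m
    exact (Real.dist_le_of_mem_Icc h1 h2).trans (by norm_num)
  · have h1 := mem_Icc_of_mem_stdSimplex hx.2 m
    have h2 := mem_Icc_of_mem_stdSimplex hy.2 m
    exact (Real.dist_le_of_mem_Icc h1 h2).trans (by norm_num)

theorem dist_approach_approach_le {E : State} (hE : E ∈ phaseSpace) (hz : z ∈ phaseSpace)
    {r r' : ℝ} (hr : 0 ≤ r) (hr' : 0 ≤ r') :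
    dist (approach E z r) (approach E z r') ≤ dist r r' := by
  wlog hle : r ≤ r' generalizing r r'
  · rw [dist_comm, dist_comm r]
    exact this hr' hr (le_of_not_ge hle)
  have e : approach E z r - approach E z r' = (Real.exp (-r) - Real.exp (-r')) • (z - E) := by
    simp only [approach]; module
  have h1 : 0 ≤ Real.exp (-r) - Real.exp (-r') :=
    sub_nonneg.2 (Real.exp_le_exp.2 (by linarith))
  have h2 : Real.exp (-r) - Real.exp (-r') ≤ r' - r := by
    have e' : Real.exp (-r') = Real.exp (-r) * Real.exp (-(r' - r)) := by
      rw [← Real.exp_add]; congr 1; ring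
    have h3 := exp_neg_mem (sub_nonneg.2 hle)
    have h4 := exp_neg_mem hr
    rw [e']
    nlinarith [Real.exp_pos (-r)]
  rw [dist_eq_norm, e, norm_smul, Real.norm_of_nonneg h1, ← dist_eq_norm, dist_comm r,
    Real.dist_eq, abs_of_nonneg (sub_nonneg.2 hle)]
  calc _ ≤ (Real.exp (-r) - Real.exp (-r')) * 1 :=
        mul_le_mul_of_nonneg_left (dist_le_one_of_mem_phaseSpace hz hE) h1
    _ ≤ _ := by linarith

theorem hasDerivAt_approach (E z : State) (s t : ℝ) :
    HasDerivAt (fun t => approach E z (t - s)) (E - approach E z (t - s)) t := by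
  have h1 : HasDerivAt (fun t : ℝ => Real.exp (-(t - s))) (-Real.exp (-(t - s))) t := by
    simpa using ((hasDerivAt_id t).sub_const s).neg.exp
  have h2 := (h1.smul_const z).add ((h1.const_sub 1).smul_const E)
  refine h2.congr_deriv ?_
  simp only [approach]
  module

theorem lipschitzOnWith_Icc_union {X : Type*} [PseudoMetricSpace X] {f : ℝ → X} {a b c : ℝ}
    (h1 : LipschitzOnWith 1 f (Set.Icc a b)) (h2 : LipschitzOnWith 1 f (Set.Icc b c)) :
    LipschitzOnWith 1 f (Set.Icc a c) := by
  refine LipschitzOnWith.of_dist_le_mul fun x hx y hy => ?_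
  wlog hxy : x ≤ y generalizing x y
  · rw [dist_comm, dist_comm x]
    exact this y hy x hx (le_of_not_ge hxy)
  rcases le_total y b with hyb | hyb
  · exact h1.dist_le_mul x ⟨hx.1, hxy.trans hyb⟩ y ⟨hy.1, hyb⟩
  rcases le_total b x with hbx | hbx
  · exact h2.dist_le_mul x ⟨hbx, hx.2⟩ y ⟨hyb, hy.2⟩
  have d1 := h1.dist_le_mul x ⟨hx.1, hbx⟩ b ⟨hx.1.trans hbx, le_rfl⟩
  have d2 := h2.dist_le_mul b ⟨le_rfl, hyb.trans hy.2⟩ y ⟨hyb, hy.2⟩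
  simp only [NNReal.coe_one, one_mul, Real.dist_eq] at d1 d2 ⊢
  rw [abs_sub_comm, abs_of_nonneg (by linarith)] at d1 d2 ⊢
  linarith [dist_triangle (f x) (f b) (f y)]

/-- The period of the Shapley orbit is three times this time between consecutive sections. -/
noncomputable def sectionGap (β : ℝ) (w : Fin 3 → ℝ) : ℝ := durA w + durB β w

/-- The Shapley orbit between two sections. -/
noncomputable def shapleyPiece (β : ℝ) (w : Fin 3 → ℝ) (r : ℝ) : State :=
  if r ≤ durA w then approach (profile 0 1) (baseState β w) r
  else approach (profile 1 1) (midState 0 (baseState β w) w) (r - durA w)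

/-- The Shapley orbit through section `0` at time `0`; after each time `sectionGap β w` it is
continued by the relabelled copy of its first piece. -/
noncomputable def shapleyCurve (β : ℝ) (w : Fin 3 → ℝ) (t : ℝ) : State :=
  rot (idx ⌊t / sectionGap β w⌋₊) (shapleyPiece β w (t - ⌊t / sectionGap β w⌋₊ * sectionGap β w))

theorem sectionGap_pos (hβ : -1 < β) (hw : ∀ k, 0 < w k) : 0 < sectionGap β w :=
  add_pos (durA_pos hw) (durB_pos hβ hw)

theorem sum_approach (i j : Fin 3) (h1 : ∑ m, z.1 m = 1) (h2 : ∑ m, z.2 m = 1) (r : ℝ) :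
    ∑ m, (approach (profile i j) z r).1 m = 1 ∧ ∑ m, (approach (profile i j) z r).2 m = 1 := by
  simp [approach, Finset.sum_add_distrib, ← Finset.mul_sum, profile, h1, h2]

theorem nextState_baseState (hβ : -1 < β) (hβ0 : β ≤ 0) (hw : ∀ k, 0 < w k)
    (hfix : gapStep β w = w) : nextState β 0 (baseState β w) w = rot 1 (baseState β w) := by
  obtain ⟨s1, s2⟩ := sum_baseState hβ hβ0 w
  obtain ⟨m1, m2⟩ := sum_approach 0 (0 + 1) s1 s2 (durA w)
  obtain ⟨n1, n2⟩ := sum_approach (0 + 1) (0 + 1) m1 m2 (durB β w)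
  have h := (isSection_baseState hβ hβ0 w).next hw hβ hβ0
  rw [hfix, zero_add] at h
  exact h.eq_rot_baseState hβ hβ0 n1 n2

theorem nonneg_of_contraction {f : Fin 3 → ℝ} {κ : ℝ} (h0 : 0 ≤ κ) (h1 : κ < 1)
    (h : ∀ m, κ * f m ≤ f (m - 1)) (m : Fin 3) : 0 ≤ f m := by
  obtain ⟨k, hk⟩ := Finite.exists_min f
  refine le_trans ?_ (hk m)
  have h2 := h (k + 1)
  rw [add_sub_cancel_right] at h2
  have h3 := mul_le_mul_of_nonneg_left (hk (k + 1)) h0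
  nlinarith

/-- The weights of the fixed section state are nonnegative: one step of the motion adds nonnegative
terms to a contraction of the weights, and the outcome is the relabelled state. -/
theorem baseState_mem_phaseSpace (hβ : -1 < β) (hβ0 : β ≤ 0) (hw : ∀ k, 0 < w k)
    (hfix : gapStep β w = w) : baseState β w ∈ phaseSpace := by
  obtain ⟨s1, s2⟩ := sum_baseState hβ hβ0 w
  have hn := nextState_baseState hβ hβ0 hw hfix
  have hA : Real.exp (-durA w) < 1 := Real.exp_lt_one_iff.2 (neg_neg_of_pos (durA_pos hw))
  have hB : Real.exp (-durB β w) < 1 := Real.exp_lt_one_iff.2 (neg_neg_of_pos (durB_pos hβ hw))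
  have pA := Real.exp_pos (-durA w)
  have pB := Real.exp_pos (-durB β w)
  have hsingle : ∀ i m : Fin 3, 0 ≤ (Pi.single i 1 : Fin 3 → ℝ) m := fun i m =>
    (single_mem_stdSimplex ℝ i).1 m
  have hκ : Real.exp (-durB β w) * Real.exp (-durA w) < 1 := by nlinarith
  refine ⟨⟨nonneg_of_contraction (mul_pos pB pA).le hκ fun m => ?_, s1⟩,
    ⟨nonneg_of_contraction (mul_pos pB pA).le hκ fun m => ?_, s2⟩⟩
  · have e := congrFun (congrArg Prod.fst hn) m
    simp only [nextState, midState, approach, rot, profile, Prod.fst_add, Prod.smul_fst,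
      Pi.add_apply, Pi.smul_apply, smul_eq_mul] at e
    rw [← e]
    have p1 := mul_nonneg pB.le (mul_nonneg (sub_nonneg.2 hA.le) (hsingle 0 m))
    have p2 := mul_nonneg (sub_nonneg.2 hB.le) (hsingle (0 + 1) m)
    linarith
  · have e := congrFun (congrArg Prod.snd hn) m
    simp only [nextState, midState, approach, rot, profile, Prod.snd_add, Prod.smul_snd,
      Pi.add_apply, Pi.smul_apply, smul_eq_mul] at e
    rw [← e]
    have p1 := mul_nonneg pB.le (mul_nonneg (sub_nonneg.2 hA.le) (hsingle (0 + 1) m))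
    have p2 := mul_nonneg (sub_nonneg.2 hB.le) (hsingle (0 + 1) m)
    linarith

theorem shapleyCurve_add (hβ : -1 < β) (hβ0 : β ≤ 0) (hw : ∀ k, 0 < w k) (hfix : gapStep β w = w)
    (n : ℕ) {r : ℝ} (hr : 0 ≤ r) (hrT : r ≤ sectionGap β w) :
    shapleyCurve β w (n * sectionGap β w + r) = rot (idx n) (shapleyPiece β w r) := by
  have hθ := sectionGap_pos hβ hw
  have hA := durA_pos hw
  have hB := durB_pos hβ hw
  rcases hrT.lt_or_eq with hlt | rfl
  · have hfl : ⌊(n * sectionGap β w + r) / sectionGap β w⌋₊ = n := by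
      rw [Nat.floor_eq_iff (by positivity), le_div_iff₀ hθ, div_lt_iff₀ hθ]
      constructor <;> linarith
    rw [shapleyCurve, hfl, add_sub_cancel_left]
  · have hfl : ⌊(n * sectionGap β w + sectionGap β w) / sectionGap β w⌋₊ = n + 1 := by
      rw [← add_one_mul, mul_div_cancel_right₀ _ hθ.ne', ← Nat.cast_succ, Nat.floor_natCast]
    rw [shapleyCurve, hfl, Nat.cast_succ, add_one_mul, sub_self, shapleyPiece, if_pos hA.le,
      approach_zero, shapleyPiece, if_neg (by rw [sectionGap]; linarith), idx_succ]
    have e := nextState_baseState hβ hβ0 hw hfix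
    rw [nextState, zero_add] at e
    rw [sectionGap, add_sub_cancel_left, e, rot_rot, add_comm]

theorem shapleyCurve_phaseA (hβ : -1 < β) (hβ0 : β ≤ 0) (hw : ∀ k, 0 < w k)
    (hfix : gapStep β w = w) (n : ℕ) {r : ℝ} (hr : 0 ≤ r) (hrT : r ≤ durA w) :
    shapleyCurve β w (n * sectionGap β w + r) =
      approach (profile (idx n) (idx n + 1)) (rot (idx n) (baseState β w)) r := by
  have hB := durB_pos hβ hw
  rw [shapleyCurve_add hβ hβ0 hw hfix n hr (by rw [sectionGap]; linarith), shapleyPiece,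
    if_pos hrT, rot_approach, rot_profile, zero_add, add_comm 1]

theorem rot_midState (k : Fin 3) : rot k (midState 0 z w) = midState k (rot k z) w := by
  rw [midState, rot_approach, rot_profile, midState, zero_add, zero_add, add_comm 1]

theorem shapleyCurve_phaseB (hβ : -1 < β) (hβ0 : β ≤ 0) (hw : ∀ k, 0 < w k)
    (hfix : gapStep β w = w) (n : ℕ) {r : ℝ} (hr : 0 ≤ r) (hrT : r ≤ durB β w) :
    shapleyCurve β w (n * sectionGap β w + durA w + r) =
      approach (profile (idx n + 1) (idx n + 1))
        (midState (idx n) (rot (idx n) (baseState β w)) w) r := by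
  have hA := durA_pos hw
  rw [add_assoc, shapleyCurve_add hβ hβ0 hw hfix n (by linarith) (by rw [sectionGap]; linarith),
    shapleyPiece]
  rcases hr.eq_or_lt with rfl | hr
  · rw [add_zero, if_pos le_rfl, approach_zero, ← rot_midState, midState, zero_add]
  · rw [if_neg (by linarith), add_sub_cancel_left, rot_approach, rot_profile, rot_midState,
      add_comm 1]

theorem isSection_rot_baseState (hβ : -1 < β) (hβ0 : β ≤ 0) (k : Fin 3) :
    IsSection β k (rot k (baseState β w)) w := by
  have := (isSection_rot (i := 0) k).2 (isSection_baseState hβ hβ0 w)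
  rwa [zero_add] at this

theorem shapleyCurve_strictA (hβ : -1 < β) (hβ0 : β ≤ 0) (hw : ∀ k, 0 < w k)
    (hfix : gapStep β w = w) (n : ℕ) {t : ℝ} (h1 : n * sectionGap β w < t)
    (h2 : t < n * sectionGap β w + durA w) :
    StrictA β (idx n) (shapleyCurve β w t) ∧ StrictB β (idx n + 1) (shapleyCurve β w t) := by
  have hsec := isSection_rot_baseState (w := w) hβ hβ0 (idx n)
  have e := shapleyCurve_phaseA hβ hβ0 hw hfix n (r := t - n * sectionGap β w) (by linarith)
    (by linarith)
  rw [add_sub_cancel] at e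
  rw [e]
  exact ⟨(hsec.leadA hw).strictA hβ hβ0 (by linarith) (by rw [hsec.timeA_eq]; linarith),
    ((hsec.leadA hw).gaps hβ hβ0 (by linarith)).2⟩

theorem shapleyCurve_strictB (hβ : -1 < β) (hβ0 : β ≤ 0) (hw : ∀ k, 0 < w k)
    (hfix : gapStep β w = w) (n : ℕ) {t : ℝ} (h1 : n * sectionGap β w + durA w < t)
    (h2 : t < (n + 1) * sectionGap β w) :
    StrictA β (idx n + 1) (shapleyCurve β w t) ∧ StrictB β (idx n + 1) (shapleyCurve β w t) := by
  have hsec := isSection_rot_baseState (w := w) hβ hβ0 (idx n)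
  have h3 : t - (n * sectionGap β w + durA w) < durB β w := by
    have : (n + 1) * sectionGap β w = n * sectionGap β w + (durA w + durB β w) := by
      rw [sectionGap]; ring
    linarith
  have e := shapleyCurve_phaseB hβ hβ0 hw hfix n (r := t - (n * sectionGap β w + durA w))
    (by linarith) h3.le
  rw [add_sub_cancel] at e
  rw [e]
  have hB := hsec.leadB hw hβ hβ0
  exact ⟨(hB.gaps hβ0 (by linarith)).2,
    hB.strictB hβ hβ0 (by linarith) (by rw [hsec.timeB_eq hw]; exact h3)⟩

theorem lipschitzOnWith_shapleyCurve (hβ : -1 < β) (hβ0 : β ≤ 0) (hw : ∀ k, 0 < w k)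
    (hfix : gapStep β w = w) (n : ℕ) :
    LipschitzOnWith 1 (shapleyCurve β w) (Set.Icc 0 (n * sectionGap β w)) := by
  have hz : ∀ k, rot k (baseState β w) ∈ phaseSpace := fun k =>
    rot_mem_phaseSpace k (baseState_mem_phaseSpace hβ hβ0 hw hfix)
  have piece : ∀ {i j z a T}, z ∈ phaseSpace → (∀ r, 0 ≤ r → r ≤ T →
      shapleyCurve β w (a + r) = approach (profile i j) z r) →
      LipschitzOnWith 1 (shapleyCurve β w) (Set.Icc a (a + T)) := by
    intro i j z a T hz h
    refine LipschitzOnWith.of_dist_le_mul fun x hx y hy => ?_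
    have hx' := h (x - a) (by linarith [hx.1]) (by linarith [hx.2])
    have hy' := h (y - a) (by linarith [hy.1]) (by linarith [hy.2])
    rw [add_sub_cancel] at hx' hy'
    rw [hx', hy', NNReal.coe_one, one_mul, ← dist_sub_right x y a]
    exact dist_approach_approach_le (profile_mem_phaseSpace i j) hz (by linarith [hx.1])
      (by linarith [hy.1])
  induction n with
  | zero =>
    refine LipschitzOnWith.of_dist_le_mul fun x hx y hy => ?_
    have hx' : x = 0 := le_antisymm (by simpa using hx.2) hx.1
    have hy' : y = 0 := le_antisymm (by simpa using hy.2) hy.1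
    simp [hx', hy']
  | succ n ih =>
    have e : ((n + 1 : ℕ) : ℝ) * sectionGap β w =
        n * sectionGap β w + durA w + durB β w := by
      rw [sectionGap]; push_cast; ring
    rw [e]
    refine lipschitzOnWith_Icc_union (lipschitzOnWith_Icc_union ih
      (piece (hz (idx n)) fun r hr hrT => shapleyCurve_phaseA hβ hβ0 hw hfix n hr hrT))
      (piece (approach_mem_phaseSpace (profile_mem_phaseSpace _ _) (hz (idx n))
        (durA_pos hw).le) fun r hr hrT => shapleyCurve_phaseB hβ hβ0 hw hfix n hr hrT)

theorem exists_nat_mul_le {θ t : ℝ} (hθ : 0 < θ) (ht : 0 ≤ t) :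
    ∃ n : ℕ, n * θ ≤ t ∧ t < (n + 1) * θ := by
  have := (Nat.floor_eq_iff (n := ⌊t / θ⌋₊) (div_nonneg ht hθ.le)).1 rfl
  rw [le_div_iff₀ hθ, div_lt_iff₀ hθ] at this
  exact ⟨_, this⟩

theorem isTrajectory_shapleyCurve (hβ : -1 < β) (hβ0 : β ≤ 0) (hw : ∀ k, 0 < w k)
    (hfix : gapStep β w = w) : IsTrajectory β (shapleyCurve β w) := by
  have hθ := sectionGap_pos hβ hw
  have hz : ∀ k, rot k (baseState β w) ∈ phaseSpace := fun k =>
    rot_mem_phaseSpace k (baseState_mem_phaseSpace hβ hβ0 hw hfix)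
  have hmid : ∀ n, midState (idx n) (rot (idx n) (baseState β w)) w ∈ phaseSpace := fun n =>
    approach_mem_phaseSpace (profile_mem_phaseSpace _ _) (hz (idx n)) (durA_pos hw).le
  refine ⟨fun t ht => ?_, fun T hT => ?_, ?_⟩
  · obtain ⟨n, h1, h2⟩ := exists_nat_mul_le hθ ht
    rcases le_total t (n * sectionGap β w + durA w) with h3 | h3
    · have e := shapleyCurve_phaseA hβ hβ0 hw hfix n (r := t - n * sectionGap β w) (by linarith)
        (by linarith)
      rw [add_sub_cancel] at e
      rw [e]
      exact approach_mem_phaseSpace (profile_mem_phaseSpace _ _) (hz _) (by linarith)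
    · have e := shapleyCurve_phaseB hβ hβ0 hw hfix n (r := t - (n * sectionGap β w + durA w))
        (by linarith) (by
          have : (n + 1) * sectionGap β w = n * sectionGap β w + (durA w + durB β w) := by
            rw [sectionGap]; ring
          linarith)
      rw [add_sub_cancel] at e
      rw [e]
      exact approach_mem_phaseSpace (profile_mem_phaseSpace _ _) (hmid n) (by linarith)
  · obtain ⟨n, -, h2⟩ := exists_nat_mul_le hθ hT
    refine ((lipschitzOnWith_shapleyCurve hβ hβ0 hw hfix (n + 1)).mono
      ?_).absolutelyContinuousOnInterval
    rw [Set.uIcc_of_le hT]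
    exact Set.Icc_subset_Icc_right (by push_cast; exact h2.le)
  · -- Switches occur at countably many times only.
    have hcount : (Set.range (fun n : ℕ => n * sectionGap β w) ∪
        Set.range fun n : ℕ => n * sectionGap β w + durA w).Countable :=
      (Set.countable_range _).union (Set.countable_range _)
    filter_upwards [hcount.ae_notMem volume] with t ht ht0
    have done : ∀ {i j z a b}, a < t → t < b →
        (∀ t', a < t' → t' < b → shapleyCurve β w t' = approach (profile i j) z (t' - a)) →
        StrictA β i (shapleyCurve β w t) → StrictB β j (shapleyCurve β w t) →
        ∃ p ∈ bestResponse (utilA β (shapleyCurve β w t)),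
          ∃ q ∈ bestResponse (utilB β (shapleyCurve β w t)),
          HasDerivAt (shapleyCurve β w) (p - (shapleyCurve β w t).1, q - (shapleyCurve β w t).2)
            t := by
      intro i j z a b ha hb h hA hB
      have le_of : ∀ {u : Fin 3 → ℝ} {i : Fin 3}, (∀ m, m ≠ i → u m < u i) → ∀ m, u m ≤ u i := by
        intro u i hu m
        by_cases hm : m = i
        · rw [hm]
        · exact (hu m hm).le
      refine ⟨_, single_mem_bestResponse (le_of hA), _, single_mem_bestResponse (le_of hB), ?_⟩
      have hd := hasDerivAt_approach (profile i j) z a t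
      have hev : shapleyCurve β w =ᶠ[𝓝 t] fun t' => approach (profile i j) z (t' - a) := by
        filter_upwards [Ioo_mem_nhds ha hb] with t' ht' using h t' ht'.1 ht'.2
      rw [← hev.eq_of_nhds] at hd
      exact hd.congr_of_eventuallyEq hev
    obtain ⟨n, h1, h2⟩ := exists_nat_mul_le hθ ht0.le
    have h1' : n * sectionGap β w < t := h1.lt_of_ne fun e => ht (Or.inl ⟨n, e⟩)
    have hsum : (n + 1) * sectionGap β w = n * sectionGap β w + durA w + durB β w := by
      rw [sectionGap]; ring
    rcases lt_trichotomy t (n * sectionGap β w + durA w) with h3 | h3 | h3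
    · obtain ⟨sA, sB⟩ := shapleyCurve_strictA hβ hβ0 hw hfix n h1' h3
      refine done (z := rot (idx n) (baseState β w)) h1' h3 (fun t' ha hb => ?_) sA sB
      rw [← shapleyCurve_phaseA hβ hβ0 hw hfix n (by linarith) (by linarith), add_sub_cancel]
    · exact absurd (Or.inr ⟨n, h3.symm⟩) ht
    · obtain ⟨sA, sB⟩ := shapleyCurve_strictB hβ hβ0 hw hfix n h3 h2
      refine done (z := midState (idx n) (rot (idx n) (baseState β w)) w) h3 h2
        (fun t' ha hb => ?_) sA sB
      rw [← shapleyCurve_phaseB hβ hβ0 hw hfix n (by linarith) (by linarith), add_sub_cancel]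

theorem shapleyCurve_periodic (hβ : -1 < β) (hβ0 : β ≤ 0) (hw : ∀ k, 0 < w k)
    (hfix : gapStep β w = w) {t : ℝ} (ht : 0 ≤ t) :
    shapleyCurve β w (t + 3 * sectionGap β w) = shapleyCurve β w t := by
  obtain ⟨n, h1, h2⟩ := exists_nat_mul_le (sectionGap_pos hβ hw) ht
  have e : t + 3 * sectionGap β w =
      (n + 3 : ℕ) * sectionGap β w + (t - n * sectionGap β w) := by push_cast; ring
  have e' := shapleyCurve_add hβ hβ0 hw hfix n (r := t - n * sectionGap β w) (by linarith)
    (by linarith)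
  rw [add_sub_cancel] at e'
  rw [e, shapleyCurve_add hβ hβ0 hw hfix (n + 3) (by linarith) (by linarith), e']
  congr 1
  ext
  simp [idx]

theorem isShapleyOrbit_shapleyCurve (hβ : -1 < β) (hβ0 : β ≤ 0) (hw : ∀ k, 0 < w k)
    (hfix : gapStep β w = w) : IsShapleyOrbit β (shapleyCurve β w '' Set.Ici 0) := by
  have hA := durA_pos hw
  have hB := durB_pos hβ hw
  have hsum : sectionGap β w = durA w + durB β w := rfl
  refine ⟨shapleyCurve β w, ![0, durA w, sectionGap β w, sectionGap β w + durA w,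
    2 * sectionGap β w, 2 * sectionGap β w + durA w, 3 * sectionGap β w],
    isTrajectory_shapleyCurve hβ hβ0 hw hfix, ?_, rfl,
    fun t ht => shapleyCurve_periodic hβ hβ0 hw hfix ht, ?_, rfl⟩
  · rw [Fin.strictMono_iff_lt_succ]
    intro k
    fin_cases k <;> simp <;> linarith
  · intro k t h1 h2
    have stepA := fun n => shapleyCurve_strictA hβ hβ0 hw hfix n (t := t)
    have stepB := fun n => shapleyCurve_strictB hβ hβ0 hw hfix n (t := t)
    fin_cases k <;> simp at h1 h2
    · exact stepA 0 (by simpa using h1) (by simpa using h2)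
    · exact stepB 0 (by simpa using h1) (by simpa using h2)
    · exact stepA 1 (by simpa using h1) (by simpa using h2)
    · exact stepB 1 (by simpa using h1) (by norm_num; linarith)
    · exact stepA 2 (by simpa using h1) (by simpa using h2)
    · exact stepB 2 (by simpa using h1) (by norm_num; linarith)

/-! ### Leaving the off-cycle regions -/

theorem isClosed_offCycle (β : ℝ) (i : Fin 3) : IsClosed {x | OffCycle β i x} := by
  simp only [OffCycle, Set.ofPred_and, Set.ofPred_forall]
  exact (isClosed_iInter fun m => isClosed_le (continuous_utilA β m) (continuous_utilA β i)).inter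
    (isClosed_iInter fun m => isClosed_le (continuous_utilB β m) (continuous_utilB β (i + 2)))

/-- The discontinuity set is where two of the off-cycle regions meet. -/
theorem mem_discontinuitySet_of_offCycle (hβ : -1 < β) (hβ0 : β ≤ 0) {x : State}
    (hx : x ∈ phaseSpace) {i j : Fin 3} (hij : i ≠ j) (hi : OffCycle β i x)
    (hj : OffCycle β j x) : x ∈ discontinuitySet β := by
  have key : ∀ i, OffCycle β i x → OffCycle β (i + 1) x → x ∈ discontinuitySet β := by
    intro i hi hj
    have e : i + 1 + 2 = i := add_one_add_two i
    rw [mem_discontinuitySet_iff hβ hβ0]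
    have hj2 := hj.2
    rw [e] at hj2
    exact ⟨hx, i, ⟨le_antisymm (hj.1 i) (hi.1 (i + 1)), hi.1⟩,
      ⟨le_antisymm (hj2 (i + 2)) (hi.2 i), hi.2⟩⟩
  have : ∀ i j : Fin 3, i ≠ j → j = i + 1 ∨ i = j + 1 := by decide
  rcases this i j hij with rfl | rfl
  · exact key i hi hj
  · exact key j hj hi

theorem utilA_prod (β : ℝ) (a b : Fin 3 → ℝ) (m : Fin 3) :
    utilA β (a, b) m = b m + β * b (m + 2) := utilA_apply β (a, b) m

theorem utilB_prod (β : ℝ) (a b : Fin 3 → ℝ) (m : Fin 3) :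
    utilB β (a, b) m = a (m + 2) - β * a m := utilB_apply β (a, b) m

/-- An observable that is nonnegative along a trajectory cannot be driven at a uniformly negative
rate forever. -/
theorem IsTrajectory.not_forall_le_neg (hγ : IsTrajectory β γ) (L : State →L[ℝ] ℝ) {s c : ℝ}
    (hs : 0 ≤ s) (hc : 0 < c) (hL : ∀ t, s ≤ t → 0 ≤ L (γ t))
    (h : ∀ t, s < t → ∀ a ∈ bestResponse (utilA β (γ t)), ∀ b ∈ bestResponse (utilB β (γ t)),
      L (a, b) ≤ -c) : False := by
  have key : ∀ t, s ≤ t → Real.exp t * c ≤ Real.exp s * (L (γ s) + c) := by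
    intro t ht
    have h1 := hγ.exp_mul_sub_le L hs ht fun r hr => h r hr.1
    have h2 := mul_nonneg (Real.exp_pos t).le (hL t ht)
    linarith
  have htend : Tendsto (fun t => Real.exp t * c) atTop atTop :=
    Real.tendsto_exp_atTop.atTop_mul_const hc
  obtain ⟨t, ht, ht'⟩ := ((eventually_ge_atTop s).and (htend.eventually
    (eventually_gt_atTop (Real.exp s * (L (γ s) + c))))).exists
  exact absurd (key t ht) (not_le.2 ht')

/-- A trajectory cannot stay in one off-cycle region forever without meeting the others. Let `y` be
A's gap between `i` and `i + 1`, and `z` B's gap between `i + 2` and `i`; off the other regions `y`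
and `z` are never both `0`. If `y` never vanishes, then A never plays `i + 1`, so that B's
utility of `i + 2` falls behind. If `y` vanishes once, it stays `0` as long as `z` is positive,
because B plays `i` only where `z = 0`; so `z` stays positive, B never plays `i`, and A's utility of
`i` falls behind. -/
theorem IsTrajectory.exists_offCycle_inter (hγ : IsTrajectory β γ) (hβ : -1 < β) (hβ0 : β ≤ 0)
    (h : ∀ t, 0 ≤ t → OffCycle β i (γ t)) : ∃ t, 0 ≤ t ∧ OffCycle β (i + 1) (γ t) := by
  by_contra! hnot
  set y : State →L[ℝ] ℝ := utilAL β i - utilAL β (i + 1) with hy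
  set z : State →L[ℝ] ℝ := utilBL β (i + 2) - utilBL β i with hz
  have y_apply : ∀ x, y x = utilA β x i - utilA β x (i + 1) := fun x => by simp [y]
  have z_apply : ∀ x, z x = utilB β x (i + 2) - utilB β x i := fun x => by simp [z]
  have hy0 : ∀ t, 0 ≤ t → 0 ≤ y (γ t) := fun t ht => by
    rw [y_apply]; exact sub_nonneg.2 ((h t ht).1 _)
  have hz0 : ∀ t, 0 ≤ t → 0 ≤ z (γ t) := fun t ht => by
    rw [z_apply]; exact sub_nonneg.2 ((h t ht).2 _)
  have hyz : ∀ t, 0 ≤ t → y (γ t) ≤ 0 → 0 < z (γ t) := by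
    intro t ht hyt
    refine (hz0 t ht).lt_of_ne fun hzt => hnot t ht ?_
    rw [y_apply] at hyt
    rw [z_apply] at hzt
    have e : i + 1 + 2 = i := add_one_add_two i
    refine ⟨fun m => ((h t ht).1 m).trans (by linarith), fun m => ?_⟩
    rw [e]
    exact ((h t ht).2 m).trans (by linarith)
  have hb0 : ∀ t, 0 ≤ t → 0 < z (γ t) → ∀ b ∈ bestResponse (utilB β (γ t)), b i = 0 := by
    intro t ht hzt b hb
    rw [z_apply] at hzt
    exact eq_zero_of_mem_bestResponse hb (sub_pos.1 hzt)
  by_cases hcase : ∀ t, 0 ≤ t → 0 < y (γ t)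
  · have hc : 0 < 1 + β := by linarith
    refine hγ.not_forall_le_neg
      ((utilBL β (i + 2) - utilBL β (i + 1)) + (2 / (1 + β)) • z) le_rfl one_pos
      (fun t ht => ?_) fun t ht a ha b hb => ?_
    · have h1 := mul_nonneg (div_pos two_pos hc).le (hz0 t ht)
      have h2 := (h t ht).2 (i + 1)
      simp only [_root_.add_apply, _root_.sub_apply, _root_.smul_apply,
        utilBL_apply, smul_eq_mul]
      linarith
    · have hyt := hcase t ht.le
      rw [y_apply] at hyt
      have ha1 : a (i + 1) = 0 := eq_zero_of_mem_bestResponse ha (sub_pos.1 hyt)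
      have hsum := sum_shift_of_mem ha.1 i
      have p0 := ha.1.1 i
      have p2 := ha.1.1 (i + 2)
      simp only [_root_.add_apply, _root_.sub_apply, _root_.smul_apply,
        utilBL_apply, smul_eq_mul, z_apply, utilB_prod, add_two_add_two, add_one_add_two, ha1]
      rw [ha1] at hsum
      have e : 2 / (1 + β) * (0 - β * a (i + 2) - (a (i + 2) - β * a i)) =
          -2 * a (i + 2) + (2 / (1 + β)) * (β * a i) := by field_simp; ring
      have p3 : (2 / (1 + β)) * (β * a i) ≤ 0 :=
        mul_nonpos_of_nonneg_of_nonpos (div_pos two_pos hc).le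
          (mul_nonpos_of_nonpos_of_nonneg hβ0 p0)
      rw [e]
      nlinarith
  · push Not at hcase
    obtain ⟨t₁, ht₁, hyt₁⟩ := hcase
    have hzpos : ∀ t, t₁ ≤ t → 0 < z (γ t) := by
      intro t ht
      have := forall_neg_of_first_zero (f := fun r => -z (γ (t₁ + r))) (T := t - t₁)
        ((z.continuous.comp_continuousOn (hγ.continuousOn_shift ht₁ _)).neg)
        (fun r hr ih => by
          refine neg_neg_of_pos (hyz _ (by linarith [hr.1]) ?_)
          have h1 := hγ.exp_mul_sub_le y (c := 0) ht₁ (t := t₁ + r) (by linarith [hr.1])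
            fun τ hτ a ha b hb => by
              have hzτ := ih (τ - t₁) ⟨by linarith [hτ.1], by linarith [hτ.2]⟩
              rw [add_sub_cancel, neg_neg_iff_pos] at hzτ
              have hb1 := hb0 τ (by linarith [hτ.1]) hzτ b hb
              have p1 := hb.1.1 (i + 1)
              have p2 := hb.1.1 (i + 2)
              simp only [y_apply, utilA_prod, add_one_add_two, hb1]
              nlinarith
          have h2 := mul_nonneg (Real.exp_pos t₁).le (sub_nonneg.2 hyt₁)
          by_contra! hpos
          have h3 := mul_pos (Real.exp_pos (t₁ + r)) hpos
          linarith)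
        (t - t₁) ⟨by linarith, le_rfl⟩
      rw [add_sub_cancel, neg_neg_iff_pos] at this
      exact this
    refine hγ.not_forall_le_neg ((utilAL β i - utilAL β (i + 2)) + y) ht₁
      (by linarith : 0 < 1 + β) (fun t ht => ?_) fun t ht a ha b hb => ?_
    · have h1 := hy0 t (ht₁.trans ht)
      have h2 := (h t (ht₁.trans ht)).1 (i + 2)
      simp only [_root_.add_apply, _root_.sub_apply, utilAL_apply]
      linarith
    · have hb1 := hb0 t (by linarith) (hzpos t ht.le) b hb
      have hsum := sum_shift_of_mem hb.1 i
      have p1 := hb.1.1 (i + 1)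
      have p2 := hb.1.1 (i + 2)
      simp only [_root_.add_apply, _root_.sub_apply, utilAL_apply, y_apply,
        utilA_prod, add_two_add_two, add_one_add_two, hb1]
      rw [hb1] at hsum
      nlinarith

/-- A trajectory that avoids the discontinuity set enters the Shapley cycle. -/
theorem IsTrajectory.exists_not_offCycle (hγ : IsTrajectory β γ) (hβ : -1 < β) (hβ0 : β ≤ 0)
    (hdisc : ∀ t, 0 ≤ t → γ t ∉ discontinuitySet β) :
    ∃ t, 0 ≤ t ∧ ∀ i, ¬ OffCycle β i (γ t) := by
  by_contra! hoff
  have hunique : ∀ t, 0 ≤ t → ∀ i j, OffCycle β i (γ t) → OffCycle β j (γ t) → i = j := by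
    intro t ht i j hi hj
    by_contra hij
    exact hdisc t ht
      (mem_discontinuitySet_of_offCycle hβ hβ0 (hγ.mem_phaseSpace t ht) hij hi hj)
  obtain ⟨i, hi⟩ := hoff 0 le_rfl
  have hclosed : ∀ j, IsClosed (Set.Ici 0 ∩ γ ⁻¹' {x | OffCycle β j x}) := fun j =>
    hγ.continuousOn.preimage_isClosed_of_isClosed isClosed_Ici (isClosed_offCycle β j)
  have hall : ∀ t, 0 ≤ t → OffCycle β i (γ t) := by
    intro t ht
    by_contra hne
    have hconn := isPreconnected_closed_iff.1 (isPreconnected_Ici (a := (0 : ℝ)))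
      _ _ (hclosed i) ((hclosed (i + 1)).union (hclosed (i + 2)))
      (fun s hs => by
        obtain ⟨j, hj⟩ := hoff s hs
        rcases (exists_fin (P := fun j => OffCycle β j (γ s)) i).1 ⟨j, hj⟩ with h | h | h
        · exact Or.inl ⟨hs, h⟩
        · exact Or.inr (Or.inl ⟨hs, h⟩)
        · exact Or.inr (Or.inr ⟨hs, h⟩))
      ⟨0, Set.mem_Ici.2 le_rfl, Set.mem_Ici.2 le_rfl, hi⟩
      ⟨t, ht, by
        obtain ⟨j, hj⟩ := hoff t ht
        rcases (exists_fin (P := fun j => OffCycle β j (γ t)) i).1 ⟨j, hj⟩ with h | h | h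
        · exact absurd h hne
        · exact Or.inl ⟨ht, h⟩
        · exact Or.inr ⟨ht, h⟩⟩
    obtain ⟨s, hs, ⟨_, h1⟩, ⟨_, h2⟩ | ⟨_, h2⟩⟩ := hconn
    · exact absurd (hunique s hs _ _ h1 h2) (by simp)
    · exact absurd (hunique s hs _ _ h1 h2) (by simp)
  obtain ⟨t, ht, h1⟩ := hγ.exists_offCycle_inter hβ hβ0 hall
  exact absurd (hunique t ht _ _ (hall t ht) h1) (by simp)

/-! ### Closed orbits outside the Shapley cycle -/

theorem snd_eq_of_utilA_eq (hβ : -1 < β) {x : State} {c : ℝ} (h : ∀ m, utilA β x m = c)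
    (hx : ∑ m, x.2 m = 1) (m : Fin 3) : x.2 m = 1 / 3 := by
  have h1 := (one_add_cube_pos hβ).ne'
  have e : ∀ k, x.2 k = x.2 m := fun k => by
    refine mul_left_cancel₀ h1 ?_
    simp only [snd_eq_utilA, h]
  rw [Fin.sum_univ_three, e 0, e 1, e 2] at hx
  linarith

theorem fst_eq_of_utilB_eq (hβ0 : β ≤ 0) {x : State} {c : ℝ} (h : ∀ m, utilB β x m = c)
    (hx : ∑ m, x.1 m = 1) (m : Fin 3) : x.1 m = 1 / 3 := by
  have h1 := (one_sub_cube_pos hβ0).ne'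
  have e : ∀ k, x.1 k = x.1 m := fun k => by
    refine mul_left_cancel₀ h1 ?_
    simp only [fst_eq_utilB, h]
  rw [Fin.sum_univ_three, e 0, e 1, e 2] at hx
  linarith

/-- Let the profile `(a, b)` be played in an off-cycle region, and suppose that the motion towards
it preserves the ties between best responses. Then the gap between a best and a worst strategy, summed
over the players, is at most `0` at `(a, b)`, so that the spread of the utilities decays. -/
theorem spread_nonpos (hβ : -1 < β) (hβ0 : β ≤ 0) {x : State} {a b : Fin 3 → ℝ}
    (ha : a ∈ bestResponse (utilA β x)) (hb : b ∈ bestResponse (utilB β x)) (h : OffCycle β i x)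
    {k l : Fin 3} (hk : ∀ m, utilA β x k ≤ utilA β x m) (hl : ∀ m, utilB β x l ≤ utilB β x m)
    (tA : ∀ m, utilA β x m = utilA β x i → utilA β (a, b) m = utilA β (a, b) i)
    (tB : ∀ m, utilB β x m = utilB β x (i + 2) → utilB β (a, b) m = utilB β (a, b) (i + 2)) :
    utilA β (a, b) i - utilA β (a, b) k + (utilB β (a, b) (i + 2) - utilB β (a, b) l) ≤ 0 := by
  have zA : ∀ m, utilA β x m < utilA β x i → a m = 0 := fun m => eq_zero_of_mem_bestResponse ha
  have zB : ∀ m, utilB β x m < utilB β x (i + 2) → b m = 0 := fun m =>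
    eq_zero_of_mem_bestResponse hb
  have maxA : ∀ m, a m ≠ 0 → utilA β x m = utilA β x i := fun m hm =>
    le_antisymm (h.1 m) (ha.2 m hm i)
  have maxB : ∀ m, b m ≠ 0 → utilB β x m = utilB β x (i + 2) := fun m hm =>
    le_antisymm (h.2 m) (hb.2 m hm (i + 2))
  -- If one player is indifferent between all strategies, then the other plays the mixed equilibrium
  -- strategy and both spreads vanish.
  by_cases dA : ∀ m, utilA β x m = utilA β x i
  · have e := snd_eq_of_utilA_eq hβ (x := (a, b)) (fun m => tA m (dA m)) hb.1.2
    have e' := fun m => tB m (maxB m (by rw [show b m = 1 / 3 from e m]; norm_num))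
    rw [tA k (dA k), e' l]
    simp
  by_cases dB : ∀ m, utilB β x m = utilB β x (i + 2)
  · have e := fst_eq_of_utilB_eq hβ0 (x := (a, b)) (fun m => tB m (dB m)) ha.1.2
    have e' := fun m => tA m (maxA m (by rw [show a m = 1 / 3 from e m]; norm_num))
    rw [tB l (dB l), e' k]
    simp
  have sA := sum_shift_of_mem ha.1 i
  have sB := sum_shift_of_mem hb.1 i
  have hk' : utilA β x k < utilA β x i := by
    by_contra! hle
    exact dA fun m => le_antisymm (h.1 m) (hle.trans (hk m))
  have hl' : utilB β x l < utilB β x (i + 2) := by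
    by_contra! hle
    exact dB fun m => le_antisymm (h.2 m) (hle.trans (hl m))
  have pA := fun m => ha.1.1 m
  have pB := fun m => hb.1.1 m
  have cA := fun m => mul_nonpos_of_nonpos_of_nonneg hβ0 (pA m)
  have cB := fun m => mul_nonpos_of_nonpos_of_nonneg hβ0 (pB m)
  have c'A : ∀ m, 0 ≤ a m + β * a m := fun m => by nlinarith [pA m]
  have c'B : ∀ m, 0 ≤ b m + β * b m := fun m => by nlinarith [pB m]
  have mA : β * a i + β * a (i + 1) + β * a (i + 2) = β := by rw [← mul_add, ← mul_add, sA, mul_one]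
  have mB : β * b i + β * b (i + 1) + β * b (i + 2) = β := by rw [← mul_add, ← mul_add, sB, mul_one]
  have z2 : a (i + 2) + β * a (i + 2) ≤ 0 → a (i + 2) ≤ 0 := fun h => by nlinarith
  have tA1 := tA (i + 1)
  have tA2 := tA (i + 2)
  have tB0 := tB i
  have tB1 := tB (i + 1)
  have zA1 := zA (i + 1)
  have zA2 := zA (i + 2)
  have zB0 := zB i
  have zB1 := zB (i + 1)
  have hk3 : k = i ∨ k = i + 1 ∨ k = i + 2 := (exists_fin (P := fun j => k = j) i).1 ⟨k, rfl⟩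
  have hl3 : l = i ∨ l = i + 1 ∨ l = i + 2 := (exists_fin (P := fun j => l = j) i).1 ⟨l, rfl⟩
  have hA1 := h.1 (i + 1)
  have hA2 := h.1 (i + 2)
  have hB0 := h.2 i
  have hB1 := h.2 (i + 1)
  simp only [utilA_prod, utilB_prod, add_one_add_two, add_two_add_two] at tA1 tA2 tB0 tB1 ⊢
  have pA0 := pA i
  have pA1 := pA (i + 1)
  have pA2 := pA (i + 2)
  have pB0 := pB i
  have pB1 := pB (i + 1)
  have pB2 := pB (i + 2)
  have cA0 := cA i
  have cA1 := cA (i + 1)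
  have cA2 := cA (i + 2)
  have cB0 := cB i
  have cB1 := cB (i + 1)
  have cB2 := cB (i + 2)
  have c'A0 := c'A i
  have c'A1 := c'A (i + 1)
  have c'A2 := c'A (i + 2)
  have c'B0 := c'B i
  have c'B1 := c'B (i + 1)
  have c'B2 := c'B (i + 2)
  have dA1 := hA1.lt_or_eq.imp zA1 tA1
  have dA2 := hA2.lt_or_eq.imp zA2 tA2
  have dB0 := hB0.lt_or_eq.imp zB0 tB0
  have dB1 := hB1.lt_or_eq.imp zB1 tB1
  clear pA pB cA cB c'A c'B zA zB tA tB maxA maxB dA dB hk hl ha hb h tA1 tA2 tB0 tB1 hA1 hA2 hB0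
    hB1
  rcases hk3 with rfl | rfl | rfl
  · exact absurd hk' (lt_irrefl _)
  · have q1 := zA1 hk'
    simp only [add_one_add_two]
    rcases hl3 with rfl | rfl | rfl
    · have q2 := zB0 hl'
      rcases dA2 with dA2 | dA2 <;> rcases dB1 with dB1 | dB1 <;> linarith
    · have q2 := zB1 hl'
      simp only [add_one_add_two]
      rcases dA2 with dA2 | dA2 <;> rcases dB0 with dB0 | dB0
      · linarith
      · linarith
      · linarith
      · have := z2 (by linarith)
        linarith
    · exact absurd hl' (lt_irrefl _)
  · have q1 := zA2 hk'
    simp only [add_two_add_two]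
    rcases hl3 with rfl | rfl | rfl
    · have q2 := zB0 hl'
      rcases dA1 with dA1 | dA1 <;> rcases dB1 with dB1 | dB1 <;> linarith
    · have q2 := zB1 hl'
      simp only [add_one_add_two]
      rcases dA1 with dA1 | dA1 <;> rcases dB0 with dB0 | dB0 <;> linarith
    · exact absurd hl' (lt_irrefl _)

/-- The largest of three numbers, such as the utilities of a player. -/
noncomputable def top (u : Fin 3 → ℝ) : ℝ := max (max (u 0) (u 1)) (u 2)

theorem le_top (u : Fin 3 → ℝ) (m : Fin 3) : u m ≤ top u := by
  fin_cases m <;> simp [top]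

theorem exists_eq_top (u : Fin 3 → ℝ) : ∃ m, u m = top u := by
  unfold top
  rcases max_choice (max (u 0) (u 1)) (u 2) with h | h <;> rw [h]
  · rcases max_choice (u 0) (u 1) with h | h <;> rw [h]
    exacts [⟨0, rfl⟩, ⟨1, rfl⟩]
  · exact ⟨2, rfl⟩

/-- Where the maximum of the observables `L m` is differentiable along a trajectory, its derivative
is that of each of the observables that attain it. -/
theorem deriv_top_eq {L : Fin 3 → State →L[ℝ] ℝ} {t : ℝ} {γ' : State} (hγ : HasDerivAt γ γ' t)
    (hd : DifferentiableAt ℝ (fun r => top fun m => L m (γ r)) t) {m : Fin 3}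
    (hm : L m (γ t) = top fun m => L m (γ t)) :
    deriv (fun r => top fun m => L m (γ r)) t = L m γ' := by
  have h1 : HasDerivAt (fun r => L m (γ r)) (L m γ') t := (L m).hasFDerivAt.comp_hasDerivAt t hγ
  have hmin : IsLocalMin (fun r => (top fun m => L m (γ r)) - L m (γ r)) t := by
    refine Eventually.of_forall fun r => ?_
    simp only [hm, sub_self]
    exact sub_nonneg.2 (le_top (fun m => L m (γ r)) m)
  exact sub_eq_zero.1 (hmin.hasDerivAt_eq_zero (hd.hasDerivAt.sub h1))

theorem IsTrajectory.absolutelyContinuousOnInterval_top (hγ : IsTrajectory β γ)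
    (L : Fin 3 → State →L[ℝ] ℝ) {T : ℝ} (hT : 0 ≤ T) :
    AbsolutelyContinuousOnInterval (fun r => top fun m => L m (γ r)) 0 T :=
  (hγ.absolutelyContinuous T hT).lipschitz_comp
    (((L 0).lipschitz.max (L 1).lipschitz).max (L 2).lipschitz)

/-- The sum over the players of the spread between their best and their worst utility. -/
noncomputable def spread (β : ℝ) (x : State) : ℝ :=
  (top fun m => utilAL β m x) + (top fun m => (-utilAL β m) x) +
    ((top fun m => utilBL β m x) + top fun m => (-utilBL β m) x)

/-- As long as a trajectory stays in the off-cycle regions, its spread decays exponentially. -/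
theorem IsTrajectory.exp_mul_spread_le (hγ : IsTrajectory β γ) (hβ : -1 < β) (hβ0 : β ≤ 0)
    (h : ∀ t, 0 ≤ t → ∃ i, OffCycle β i (γ t)) {t : ℝ} (ht : 0 ≤ t) :
    Real.exp t * spread β (γ t) ≤ spread β (γ 0) := by
  have ac1 := hγ.absolutelyContinuousOnInterval_top (fun m => utilAL β m) ht
  have ac2 := hγ.absolutelyContinuousOnInterval_top (fun m => -utilAL β m) ht
  have ac3 := hγ.absolutelyContinuousOnInterval_top (fun m => utilBL β m) ht
  have ac4 := hγ.absolutelyContinuousOnInterval_top (fun m => -utilBL β m) ht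
  have he : AbsolutelyContinuousOnInterval Real.exp 0 t :=
    (Real.contDiff_exp (n := 1)).contDiffOn.absolutelyContinuousOnInterval
  have hac : AbsolutelyContinuousOnInterval (fun r => Real.exp r * spread β (γ r)) 0 t :=
    he.fun_mul ((ac1.fun_add ac2).fun_add (ac3.fun_add ac4))
  suffices hmono : Real.exp t * spread β (γ t) ≤ Real.exp 0 * spread β (γ 0) by
    simpa using hmono
  refine hac.le_of_ae_deriv_nonpos ht ?_
  filter_upwards [hγ.inclusion, ac1.ae_differentiableAt, ac2.ae_differentiableAt,
    ac3.ae_differentiableAt, ac4.ae_differentiableAt] with r hr d1 d2 d3 d4 hrt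
  have hr' : r ∈ Set.uIcc 0 t := by
    rw [Set.uIcc_of_le ht]; exact ⟨hrt.1.le, hrt.2.le⟩
  obtain ⟨a, ha, b, hb, hd⟩ := hr hrt.1
  obtain ⟨i, hi⟩ := h r hrt.1.le
  have e1 := fun m hm => deriv_top_eq (m := m) hd (d1 hr') hm
  have e2 := fun m hm => deriv_top_eq (m := m) hd (d2 hr') hm
  have e3 := fun m hm => deriv_top_eq (m := m) hd (d3 hr') hm
  have e4 := fun m hm => deriv_top_eq (m := m) hd (d4 hr') hm
  have hsub : ((a - (γ r).1, b - (γ r).2) : State) = (a, b) - γ r := rfl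
  have topA : (top fun m => utilAL β m (γ r)) = utilA β (γ r) i := by
    obtain ⟨m, hm⟩ := exists_eq_top fun m => utilAL β m (γ r)
    have := le_top (fun m => utilAL β m (γ r)) i
    simp only [utilAL_apply] at hm this ⊢
    exact le_antisymm (hm ▸ hi.1 m) this
  have topB : (top fun m => utilBL β m (γ r)) = utilB β (γ r) (i + 2) := by
    obtain ⟨m, hm⟩ := exists_eq_top fun m => utilBL β m (γ r)
    have := le_top (fun m => utilBL β m (γ r)) (i + 2)
    simp only [utilBL_apply] at hm this ⊢
    exact le_antisymm (hm ▸ hi.2 m) this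
  obtain ⟨k, hk⟩ := exists_eq_top fun m => (-utilAL β m) (γ r)
  obtain ⟨l, hl⟩ := exists_eq_top fun m => (-utilBL β m) (γ r)
  have hk' := fun m => hk ▸ le_top (fun m => (-utilAL β m) (γ r)) m
  have hl' := fun m => hl ▸ le_top (fun m => (-utilBL β m) (γ r)) m
  have f1 := e1 i (by rw [topA, utilAL_apply])
  have f2 := e2 k hk
  have f3 := e3 (i + 2) (by rw [topB, utilBL_apply])
  have f4 := e4 l hl
  have hderiv := (Real.hasDerivAt_exp r).fun_mul (((d1 hr').hasDerivAt.fun_add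
    (d2 hr').hasDerivAt).fun_add ((d3 hr').hasDerivAt.fun_add (d4 hr').hasDerivAt))
  simp only [spread]
  rw [hderiv.deriv]
  rw [f1, f2, f3, f4]
  simp only [hsub, map_sub, neg_apply, utilAL_apply, utilBL_apply] at hk' hl' hk hl ⊢
  have key := spread_nonpos hβ hβ0 ha hb hi (k := k) (l := l)
    (fun m => by simpa using hk' m) (fun m => by simpa using hl' m)
    (fun m hm => by
      have := (e1 m (by rw [topA, utilAL_apply, hm])).symm.trans f1
      simp only [hsub, map_sub] at this
      simp only [utilAL_apply, hm] at this
      linarith)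
    (fun m hm => by
      have := (e3 m (by rw [topB, utilBL_apply, hm])).symm.trans f3
      simp only [hsub, map_sub] at this
      simp only [utilBL_apply, hm] at this
      linarith)
  simp only [utilAL_apply] at topA
  simp only [utilBL_apply] at topB
  rw [topA, topB, ← hk, ← hl]
  have hexp := mul_nonneg (Real.exp_pos r).le (neg_nonneg.2 key)
  linarith

theorem eq_of_spread_nonpos (hβ : -1 < β) (hβ0 : β ≤ 0) {x : State} (hx : x ∈ phaseSpace)
    (h : spread β x ≤ 0) : x = (fun _ => 1 / 3, fun _ => 1 / 3) := by
  have a1 := le_top fun m => utilAL β m x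
  have a2 := le_top fun m => (-utilAL β m) x
  have b1 := le_top fun m => utilBL β m x
  have b2 := le_top fun m => (-utilBL β m) x
  unfold spread at h
  have pA : ∀ m k, utilA β x m = utilA β x k := by
    intro m k
    have h1 := a1 m
    have h2 := a2 m
    have h3 := a1 k
    have h4 := a2 k
    have h5 := b1 0
    have h6 := b2 0
    simp only [neg_apply, utilAL_apply, utilBL_apply] at h h1 h2 h3 h4 h5 h6
    linarith
  have pB : ∀ m k, utilB β x m = utilB β x k := by
    intro m k
    have h1 := b1 m
    have h2 := b2 m
    have h3 := b1 k
    have h4 := b2 k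
    have h5 := a1 0
    have h6 := a2 0
    simp only [neg_apply, utilAL_apply, utilBL_apply] at h h1 h2 h3 h4 h5 h6
    linarith
  exact Prod.ext (funext fun m => fst_eq_of_utilB_eq hβ0 (fun m => pB m 0) hx.1.2 m)
    (funext fun m => snd_eq_of_utilA_eq hβ (fun m => pA m 0) hx.2.2 m)

/-- A nonconstant periodic trajectory enters the Shapley cycle. -/
theorem IsTrajectory.exists_not_offCycle_of_periodic (hγ : IsTrajectory β γ) (hβ : -1 < β)
    (hβ0 : β ≤ 0) {T : ℝ} (hT : 0 < T) (hper : ∀ t, 0 ≤ t → γ (t + T) = γ t)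
    (hne : ∃ t, 0 ≤ t ∧ γ t ≠ γ 0) : ∃ t, 0 ≤ t ∧ ∀ i, ¬ OffCycle β i (γ t) := by
  by_contra! hoff
  have hcenter : ∀ t, 0 ≤ t → γ t = (fun _ => 1 / 3, fun _ => 1 / 3) := by
    intro t ht
    refine eq_of_spread_nonpos hβ hβ0 (hγ.mem_phaseSpace t ht) ?_
    by_contra! hpos
    have htend : Tendsto (fun n : ℕ => Real.exp (t + n * T) * spread β (γ t)) atTop atTop :=
      (Real.tendsto_exp_atTop.comp (tendsto_atTop_add_const_left _ _
        (tendsto_natCast_atTop_atTop.atTop_mul_const hT))).atTop_mul_const hpos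
    obtain ⟨n, hn⟩ := (htend.eventually (eventually_gt_atTop (spread β (γ 0)))).exists
    have h1 := hγ.exp_mul_spread_le hβ hβ0 hoff (t := t + n * T) (add_nonneg ht (by positivity))
    rw [eq_of_periodic hT hper n ht] at h1
    exact absurd h1 (not_le.2 hn)
  obtain ⟨t, ht, hne⟩ := hne
  exact hne ((hcenter t ht).trans (hcenter 0 le_rfl).symm)

/-! ### The Shapley orbit is the only closed orbit and attracts -/

theorem IsTrajectory.isClosed_image_of_periodic (hγ : IsTrajectory β γ) {T : ℝ} (hT : 0 < T)
    (hper : ∀ t, 0 ≤ t → γ (t + T) = γ t) : IsClosed (γ '' Set.Ici 0) := by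
  have e : γ '' Set.Ici 0 = γ '' Set.Icc 0 T := by
    refine Set.Subset.antisymm ?_ (Set.image_mono fun t ht => ht.1)
    rintro _ ⟨t, ht, rfl⟩
    obtain ⟨n, h1, h2⟩ := exists_nat_mul_le hT ht
    refine ⟨t - n * T, ⟨by linarith, by linarith⟩, ?_⟩
    rw [← eq_of_periodic hT hper n (by linarith), sub_add_cancel]
  rw [e]
  exact (isCompact_Icc.image_of_continuousOn
    (hγ.continuousOn.mono fun t ht => ht.1)).isClosed

end FictitiousPlay

theorem theorem2 (β : ℝ) (hβ : -1 < β) (hβ0 : β ≤ 0) :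
    ∃ O : Set FictitiousPlay.State,
      FictitiousPlay.IsShapleyOrbit β O ∧
      FictitiousPlay.IsClosedOrbit β O ∧
      (∀ O' : Set FictitiousPlay.State, FictitiousPlay.IsClosedOrbit β O' → O' = O) ∧
      ∀ γ : ℝ → FictitiousPlay.State, FictitiousPlay.IsTrajectory β γ →
        (∀ t : ℝ, 0 ≤ t → γ t ∉ FictitiousPlay.discontinuitySet β) →
        Tendsto (fun t : ℝ => Metric.infDist (γ t) O) atTop (𝓝 0) := by
  open FictitiousPlay in
  obtain ⟨w, hw, heig⟩ := exists_gap_fixed hβ hβ0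
  have hfix := gapStep_fixed hβ hw heig
  have hA := durA_pos hw
  have hθ := sectionGap_pos hβ hw
  have hg := isTrajectory_shapleyCurve hβ hβ0 hw hfix
  have hper : ∀ t, 0 ≤ t → shapleyCurve β w (t + 3 * sectionGap β w) = shapleyCurve β w t :=
    fun t ht => shapleyCurve_periodic hβ hβ0 hw hfix ht
  have h0 : IsSection β 0 (shapleyCurve β w 0) w := by
    have e := shapleyCurve_phaseA hβ hβ0 hw hfix 0 le_rfl hA.le
    simp only [Nat.cast_zero, zero_mul, add_zero, approach_zero, idx_zero] at e
    rw [e]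
    exact isSection_rot_baseState hβ hβ0 0
  -- Player A's best response changes along the curve, so that it is not constant.
  have hne : ∃ t, 0 ≤ t ∧ shapleyCurve β w t ≠ shapleyCurve β w 0 := by
    have hsum : sectionGap β w = durA w + durB β w := rfl
    have hB := durB_pos hβ hw
    obtain ⟨s1, -⟩ := shapleyCurve_strictB hβ hβ0 hw hfix 0 (t := durA w + durB β w / 2)
      (by simp; linarith) (by simp; linarith)
    refine ⟨durA w + durB β w / 2, by linarith, fun e => ?_⟩
    rw [e] at s1
    exact lt_asymm (s1 0 (by simp)) ((h0.leadA hw).1 1 (by simp))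
  refine ⟨_, isShapleyOrbit_shapleyCurve hβ hβ0 hw hfix,
    ⟨_, _, hg, mul_pos three_pos hθ, hper, hne, rfl⟩, ?_, ?_⟩
  · rintro _ ⟨γ, T, hγ, hT, hperγ, hneγ, rfl⟩
    obtain ⟨t, ht, hoff⟩ := hγ.exists_not_offCycle_of_periodic hβ hβ0 hT hperγ hneγ
    obtain ⟨s, i, v, hs, hv, hsec⟩ := hγ.exists_isSection hβ hβ0 ht hoff
    refine Set.Subset.antisymm ?_ ?_
    · have hlim := tendsto_infDist_of_isSection hγ hg hβ hβ0 hs hsec hv hw heig h0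
      have hclosed := hg.isClosed_image_of_periodic (mul_pos three_pos hθ) hper
      rintro _ ⟨r, hr, rfl⟩
      have h1 : Tendsto (fun n : ℕ => Metric.infDist (γ (r + n * T))
          (shapleyCurve β w '' Set.Ici 0)) atTop (𝓝 0) :=
        hlim.comp (tendsto_atTop_add_const_left _ _
          (tendsto_natCast_atTop_atTop.atTop_mul_const hT))
      simp only [eq_of_periodic hT hperγ _ hr] at h1
      rw [hclosed.mem_iff_infDist_zero ⟨_, 0, Set.mem_Ici.2 le_rfl, rfl⟩]
      exact tendsto_nhds_unique tendsto_const_nhds h1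
    · rintro _ ⟨r, hr, rfl⟩
      rw [(hγ.isClosed_image_of_periodic hT hperγ).mem_iff_infDist_zero
        ⟨_, 0, Set.mem_Ici.2 le_rfl, rfl⟩]
      exact infDist_eq_zero_of_isSection hγ hg hβ hβ0 hs hsec hv hw heig h0 hper hr
  · intro γ hγ hdisc
    obtain ⟨t, ht, hoff⟩ := hγ.exists_not_offCycle hβ hβ0 hdisc
    obtain ⟨s, i, v, hs, hv, hsec⟩ := hγ.exists_isSection hβ hβ0 ht hoff
    exact tendsto_infDist_of_isSection hγ hg hβ hβ0 hs hsec hv hw heig h0
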